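/- Let $A=\{a,b\}$, let $A^*$ be the free monoid of all words over $A$ (with empty word $\varepsilon$), and let $K$ be a field. **Thompson groups.** A right ideal of $A^*$ is a set $R\subseteq A^*$ with $RA^*\subseteq R$; it is *essential* if it meets every nonempty right ideal. A *prefix code* is a set of words none of which is a strict prefix of another; a prefix code is *maximal* if it is not a strict subset of a prefix code. Every right ideal is $PA^*$ for exactly one prefix code $P$; it is *finitely generated* if $P$ is finite. An isomorphism between right ideals $R_1,R_2$ is a bijection $\varphi:R_1\to R_2$ with $\varphi(ux)=\varphi(u)x$ for all $u\in R_1$, $x\in A^*$; it is *maximal* if it has no strict extension to an isomorphism between right ideals. Every isomorphism $\varphi$ between essential right ideals has a unique maximal extension $\max\varphi$. The Thompson group $\mathcal G_{2,1}$ is the set of all maximal isomorphisms between essential right ideals of $A^*$, with product $\varphi\cdot\psi=\max(\varphi\circ\psi)$ (where $\psi$ is applied first); the Thompson group $V$ is its subgroup of all maximal isomorphisms between finitely generated essential right ideals. **The algebra $\mathcal C_V$.** The polycyclic monoid $PC(a,b)$ is the inverse monoid with zero presented by the generators $a,b$ and the relations $a^{-1}a=b^{-1}b=1$, $a^{-1}b=b^{-1}a=0$;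 its nonzero elements are the $yx^{-1}$ with $y,x\in A^*$, and $(y,x)$ is determined by $yx^{-1}$. Let $K[PC(a,b)]$ be the algebra of the finite sums $\sum\kappa_i y_ix_i^{-1}$, that is, the monoid algebra of $PC(a,b)$ over $K$ in which the zero of the monoid is identified with the zero of the algebra. Let $I_V$ be its two-sided ideal generated by $aa^{-1}+bb^{-1}-1$, and let $\mathcal C_V=K[PC(a,b)]/I_V$. Let $\mathcal U_V\subset K[PC(a,b)]$ be the set of all sums $\sum_{i\in I}y_ix_i^{-1}$ where $I$ is finite and $i\mapsto x_i$ and $i\mapsto y_i$ are bijections from $I$ onto maximal prefix codes, and let $\mathcal U_V/I_V$ be the image of $\mathcal U_V$ in $\mathcal C_V$. **The algebra $\mathcal C_\infty$.** Let $\mathcal B_\infty$ be the algebra of all (possibly infinite) formal sums $\sum_{y,x\in A^*}\kappa_{y,x}\,yx^{-1}$ with $\kappa_{y,x}\in K$ such that for every $y$ there are only finitely many $x$, and for every $x$ only finitely many $y$, with $\kappa_{y,x}\ne0$; sums are multiplied by means of the product of $PC(a,b)$, each coefficient of a product being a finite sum. Let $\mathcal U_\infty\subset\mathcal B_\infty$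 be the set of all sums $\sum_{i\in I}y_ix_i^{-1}$, $I\subseteq\mathbb N$, such that $i\mapsto x_i$ and $i\mapsto y_i$ are bijections from $I$ onto maximal prefix codes, and let $\mathcal U_\infty^{\rm part}$ be defined in the same way with (not necessarily maximal) prefix codes. Let $\mathcal A_\infty$ be the subalgebra of $\mathcal B_\infty$ generated by $\mathcal U_\infty^{\rm part}$. Let $I_\infty$ be the two-sided ideal of $\mathcal A_\infty$ generated by all the sums $$\sum_{i\in I}y_i\Big(\sum_{q\in Q_i}qq^{-1}-1\Big)x_i^{-1},$$ where $I\subseteq\mathbb N$, $i\mapsto x_i$ and $i\mapsto y_i$ are bijections from $I$ onto maximal prefix codes, and every $Q_i$ is a maximal prefix code. Let $\mathcal C_\infty=\mathcal A_\infty/I_\infty$, and let $\mathcal U_\infty/I_\infty$ be the image of $\mathcal U_\infty$ in $\mathcal C_\infty$. **Theorem.** (1) The set $\mathcal U_V/I_V$ is a subgroup of the group of units of $\mathcal C_V$, and this group is isomorphic to $V$. (2) The set $\mathcal U_\infty/I_\infty$ is a subgroup of the group of units of $\mathcal C_\infty$, and this group is isomorphic to $\mathcal G_{2,1}$. -/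

import Mathlib

/-- The two-letter alphabet `A = {a, b}`. -/
inductive Letter
  | a
  | b
  deriving DecidableEq

instance : Fintype Letter := ⟨{Letter.a, Letter.b}, by intro x; cases x <;> decide⟩

/-- The free monoid `A* = {a, b}*`; the product of words is concatenation `++`. -/
abbrev Word := List Letter

namespace Thompson

/-! ### Right ideals and prefix codes of `{a, b}*` -/

/-- `R` is a right ideal: `R · A* ⊆ R`. -/
def IsRightIdeal (R : Set Word) : Prop := ∀ u ∈ R, ∀ x : Word, u ++ x ∈ R

/-- `R` is an essential right ideal: it meets every (nonempty) right ideal. -/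
def IsEssential (R : Set Word) : Prop :=
  IsRightIdeal R ∧ ∀ J : Set Word, IsRightIdeal J → J.Nonempty → (R ∩ J).Nonempty

/-- A prefix code: no element is a strict prefix of another element. -/
def IsPrefixCode (C : Set Word) : Prop := ∀ u ∈ C, ∀ v ∈ C, u <+: v → u = v

/-- A maximal prefix code: a prefix code that is not a strict subset of a prefix code. -/
def IsMaximalPrefixCode (C : Set Word) : Prop :=
  IsPrefixCode C ∧ ∀ D : Set Word, IsPrefixCode D → C ⊆ D → C = D

/-- `P · A*`. -/
def generatedBy (P : Set Word) : Set Word := {w | ∃ p ∈ P, ∃ x : Word, w = p ++ x}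

/-- The right ideal `R` is finitely generated: its prefix code is finite. -/
def IsFinGen (R : Set Word) : Prop := ∃ P : Set Word, IsPrefixCode P ∧ P.Finite ∧ R = generatedBy P

/-! ### Right-ideal isomorphisms

A partial bijection of `A*` is a `Word ≃. Word`; the relation `φ ≤ Φ` says that `Φ` extends `φ`. -/

/-- The domain of a partial bijection. -/
def dom (φ : Word ≃. Word) : Set Word := {u | ∃ v, v ∈ φ u}

/-- The range of a partial bijection. -/
def ran (φ : Word ≃. Word) : Set Word := {v | ∃ u, v ∈ φ u}

/-- `φ` is an isomorphism between right ideals: its domain and range are right ideals, and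
`φ (u x) = φ (u) x` for all `u` in the domain and all words `x`. -/
structure IsRightIdealIso (φ : Word ≃. Word) : Prop where
  dom_ideal : IsRightIdeal (dom φ)
  ran_ideal : IsRightIdeal (ran φ)
  map_append : ∀ u v : Word, v ∈ φ u → ∀ x : Word, v ++ x ∈ φ (u ++ x)

/-- `φ` is an isomorphism between essential right ideals. -/
structure IsEssentialIso (φ : Word ≃. Word) : Prop extends IsRightIdealIso φ where
  dom_essential : IsEssential (dom φ)
  ran_essential : IsEssential (ran φ)

/-- `φ` is a maximal isomorphism between essential right ideals: it has no strict extension to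
an isomorphism between right ideals. -/
structure IsMaximalIso (φ : Word ≃. Word) : Prop extends IsEssentialIso φ where
  maximal : ∀ Φ : Word ≃. Word, IsRightIdealIso Φ → φ ≤ Φ → Φ = φ

theorem IsEssential.exists_append {R : Set Word} (h : IsEssential R) (u : Word) :
    ∃ x : Word, u ++ x ∈ R := by
  obtain ⟨w, hw, x, rfl⟩ := h.2 {w | ∃ x : Word, w = u ++ x}
    (by rintro _ ⟨x, rfl⟩ y; exact ⟨x ++ y, by simp⟩) ⟨u, [], by simp⟩
  exact ⟨x, hw⟩

theorem isEssential_of_exists {R : Set Word} (hR : IsRightIdeal R)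
    (h : ∀ u : Word, ∃ x : Word, u ++ x ∈ R) : IsEssential R := by
  refine ⟨hR, fun J hJ ⟨u, hu⟩ => ?_⟩
  obtain ⟨x, hx⟩ := h u
  exact ⟨u ++ x, hx, hJ u hu x⟩

theorem dom_symm (φ : Word ≃. Word) : dom φ.symm = ran φ := by
  ext v; simp [dom, ran, ← PEquiv.mem_iff_mem φ]

theorem ran_symm (φ : Word ≃. Word) : ran φ.symm = dom φ := by
  ext v; simp [dom, ran, ← PEquiv.mem_iff_mem φ]

theorem IsRightIdealIso.symm {φ : Word ≃. Word} (h : IsRightIdealIso φ) :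
    IsRightIdealIso φ.symm where
  dom_ideal := by rw [dom_symm]; exact h.ran_ideal
  ran_ideal := by rw [ran_symm]; exact h.dom_ideal
  map_append u v hv x := by
    rw [PEquiv.mem_iff_mem] at hv ⊢
    exact h.map_append _ _ hv x

theorem IsEssentialIso.symm {φ : Word ≃. Word} (h : IsEssentialIso φ) :
    IsEssentialIso φ.symm where
  toIsRightIdealIso := h.toIsRightIdealIso.symm
  dom_essential := by rw [dom_symm]; exact h.ran_essential
  ran_essential := by rw [ran_symm]; exact h.dom_essential

theorem symm_le_symm {φ ψ : Word ≃. Word} (h : φ ≤ ψ) : φ.symm ≤ ψ.symm := by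
  intro a b hb
  exact (PEquiv.mem_iff_mem ψ).2 (h _ _ ((PEquiv.mem_iff_mem φ).1 hb))

theorem IsMaximalIso.symm {φ : Word ≃. Word} (h : IsMaximalIso φ) : IsMaximalIso φ.symm where
  toIsEssentialIso := h.toIsEssentialIso.symm
  maximal Φ hΦ hle := by
    have := h.maximal Φ.symm hΦ.symm (by simpa using symm_le_symm hle)
    rw [← this, PEquiv.symm_symm]

theorem trans_le_trans {φ φ' ψ ψ' : Word ≃. Word} (h : φ ≤ φ') (h' : ψ ≤ ψ') :
    φ.trans ψ ≤ φ'.trans ψ' := by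
  intro a c hc
  rw [PEquiv.mem_trans] at hc ⊢
  obtain ⟨b, hb, hc⟩ := hc
  exact ⟨b, h _ _ hb, h' _ _ hc⟩

/-- It is enough to check that `φ` is equivariant. -/
theorem isRightIdealIso_of_map_append {φ : Word ≃. Word}
    (h : ∀ u v : Word, v ∈ φ u → ∀ x : Word, v ++ x ∈ φ (u ++ x)) : IsRightIdealIso φ where
  dom_ideal := fun u ⟨v, hv⟩ x => ⟨v ++ x, h u v hv x⟩
  ran_ideal := fun v ⟨u, hv⟩ x => ⟨u ++ x, h u v hv x⟩
  map_append := h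

/-- The composition of two isomorphisms between essential right ideals is again one. -/
theorem IsEssentialIso.trans {φ ψ : Word ≃. Word} (hφ : IsEssentialIso φ)
    (hψ : IsEssentialIso ψ) : IsEssentialIso (φ.trans ψ) := by
  have key : ∀ {φ ψ : Word ≃. Word}, IsEssentialIso φ → IsEssentialIso ψ →
      ∀ u : Word, ∃ x : Word, u ++ x ∈ dom (φ.trans ψ) := by
    intro φ ψ hφ hψ u
    obtain ⟨x, v, hv⟩ := hφ.dom_essential.exists_append u
    obtain ⟨y, w, hw⟩ := hψ.dom_essential.exists_append v
    refine ⟨x ++ y, w, (PEquiv.mem_trans _ _ _ _).2 ⟨v ++ y, ?_, hw⟩⟩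
    rw [← List.append_assoc]
    exact hφ.map_append _ _ hv y
  have hiso : IsRightIdealIso (φ.trans ψ) := by
    refine isRightIdealIso_of_map_append fun u w hw x => ?_
    rw [PEquiv.mem_trans] at hw ⊢
    obtain ⟨v, hv, hw⟩ := hw
    exact ⟨v ++ x, hφ.map_append _ _ hv x, hψ.map_append _ _ hw x⟩
  refine ⟨hiso, isEssential_of_exists hiso.dom_ideal (key hφ hψ),
    isEssential_of_exists hiso.ran_ideal ?_⟩
  rw [← dom_symm, PEquiv.symm_trans_rev]
  exact key hψ.symm hφ.symm

theorem eq_of_append_eq {u v x : Word} (h : u ++ x = v ++ x) : u = v :=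
  List.append_cancel_right h

/-- Every isomorphism between essential right ideals has a unique maximal extension. -/
theorem existsUnique_maximal {φ : Word ≃. Word} (hφ : IsEssentialIso φ) :
    ∃! Φ : Word ≃. Word, IsMaximalIso Φ ∧ φ ≤ Φ := by
  classical
  let E : Word → Word → Prop := fun u v => ∃ Φ : Word ≃. Word, IsRightIdealIso Φ ∧ φ ≤ Φ ∧ v ∈ Φ u
  have hfun : ∀ u v v', E u v → E u v' → v = v' := by
    rintro u v v' ⟨Φ, hΦ, hle, hv⟩ ⟨Φ', hΦ', hle', hv'⟩
    obtain ⟨x, w, hw⟩ := hφ.dom_essential.exists_append u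
    have h1 := Option.mem_unique (hle _ _ hw) (hΦ.map_append _ _ hv x)
    have h2 := Option.mem_unique (hle' _ _ hw) (hΦ'.map_append _ _ hv' x)
    exact eq_of_append_eq (h1.symm.trans h2)
  have hinj : ∀ u u' v, E u v → E u' v → u = u' := by
    rintro u u' v ⟨Φ, hΦ, hle, hv⟩ ⟨Φ', hΦ', hle', hv'⟩
    obtain ⟨x, w, hw⟩ := hφ.ran_essential.exists_append v
    have h1 := Φ.inj (hle _ _ hw) (hΦ.map_append _ _ hv x)
    have h2 := Φ'.inj (hle' _ _ hw) (hΦ'.map_append _ _ hv' x)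
    exact eq_of_append_eq (h1.symm.trans h2)
  let M : Word ≃. Word :=
    { toFun := fun u => if h : ∃ v, E u v then some h.choose else none
      invFun := fun v => if h : ∃ u, E u v then some h.choose else none
      inv := by
        intro u v
        have h1 : (if h : ∃ v, E u v then some h.choose else none) = some v ↔ E u v := by
          by_cases h : ∃ v, E u v
          · rw [dif_pos h, Option.some_inj]
            exact ⟨fun e => e ▸ h.choose_spec, fun e => hfun _ _ _ h.choose_spec e⟩
          · rw [dif_neg h]
            exact ⟨fun e => (Option.some_ne_none _ e.symm).elim, fun e => (h ⟨v, e⟩).elim⟩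
        have h2 : (if h : ∃ u, E u v then some h.choose else none) = some u ↔ E u v := by
          by_cases h : ∃ u, E u v
          · rw [dif_pos h, Option.some_inj]
            exact ⟨fun e => e ▸ h.choose_spec, fun e => hinj _ _ _ h.choose_spec e⟩
          · rw [dif_neg h]
            exact ⟨fun e => (Option.some_ne_none _ e.symm).elim, fun e => (h ⟨u, e⟩).elim⟩
        exact h2.trans h1.symm }
  have hM : ∀ u v, v ∈ M u ↔ E u v := by
    intro u v
    change (if h : ∃ v, E u v then some h.choose else none) = some v ↔ E u v
    by_cases h : ∃ v, E u v
    · rw [dif_pos h, Option.some_inj]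
      exact ⟨fun e => e ▸ h.choose_spec, fun e => hfun _ _ _ h.choose_spec e⟩
    · rw [dif_neg h]
      exact ⟨fun e => (Option.some_ne_none _ e.symm).elim, fun e => (h ⟨v, e⟩).elim⟩
  have hle : φ ≤ M := fun u v hv => (hM u v).2 ⟨φ, hφ.toIsRightIdealIso, le_rfl, hv⟩
  have hiso : IsRightIdealIso M := by
    refine isRightIdealIso_of_map_append fun u v hv x => ?_
    obtain ⟨Φ, hΦ, hle, hv⟩ := (hM u v).1 hv
    exact (hM _ _).2 ⟨Φ, hΦ, hle, hΦ.map_append _ _ hv x⟩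
  have hmax : ∀ Φ : Word ≃. Word, IsRightIdealIso Φ → φ ≤ Φ → Φ ≤ M :=
    fun Φ hΦ hle u v hv => (hM u v).2 ⟨Φ, hΦ, hle, hv⟩
  refine ⟨M, ⟨⟨⟨hiso, ?_, ?_⟩, ?_⟩, hle⟩, ?_⟩
  · refine isEssential_of_exists hiso.dom_ideal fun u => ?_
    obtain ⟨x, w, hw⟩ := hφ.dom_essential.exists_append u
    exact ⟨x, w, hle _ _ hw⟩
  · refine isEssential_of_exists hiso.ran_ideal fun u => ?_
    obtain ⟨x, w, hw⟩ := hφ.ran_essential.exists_append u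
    exact ⟨x, w, hle _ _ hw⟩
  · exact fun Φ hΦ h => le_antisymm (hmax Φ hΦ (hle.trans h)) h
  · rintro Φ ⟨hΦ, h⟩
    exact (hΦ.maximal M hiso (hmax Φ hΦ.toIsRightIdealIso h)).symm

/-- `max φ`: the maximum extension of an isomorphism `φ` between essential right ideals. -/
noncomputable def maxExt (φ : Word ≃. Word) (hφ : IsEssentialIso φ) : Word ≃. Word :=
  (existsUnique_maximal hφ).choose

theorem maxExt_maximal {φ : Word ≃. Word} (hφ : IsEssentialIso φ) : IsMaximalIso (maxExt φ hφ) :=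
  (existsUnique_maximal hφ).choose_spec.1.1

theorem le_maxExt {φ : Word ≃. Word} (hφ : IsEssentialIso φ) : φ ≤ maxExt φ hφ :=
  (existsUnique_maximal hφ).choose_spec.1.2

theorem eq_of_le_of_le {φ Φ Ψ : Word ≃. Word} (hφ : IsEssentialIso φ) (hΦ : IsMaximalIso Φ)
    (hΨ : IsMaximalIso Ψ) (h : φ ≤ Φ) (h' : φ ≤ Ψ) : Φ = Ψ :=
  (existsUnique_maximal hφ).unique ⟨hΦ, h⟩ ⟨hΨ, h'⟩

theorem refl_maximal : IsMaximalIso (PEquiv.refl Word) := by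
  have hdom : dom (PEquiv.refl Word) = Set.univ := by ext u; simp [dom]
  have hran : ran (PEquiv.refl Word) = Set.univ := by ext u; simp [ran]
  have huniv : IsEssential Set.univ :=
    ⟨fun _ _ _ => trivial, fun J _ hJ => by simpa using hJ⟩
  refine ⟨⟨isRightIdealIso_of_map_append ?_, hdom ▸ huniv, hran ▸ huniv⟩, ?_⟩
  · intro u v hv x
    simp only [PEquiv.refl_apply, Option.mem_def, Option.some_inj] at hv ⊢
    rw [hv]
  · intro Φ _ h
    ext1 u
    exact h u u rfl

/-! ### The Thompson groups -/

/-- The set underlying the Thompson group `𝒢_{2,1}`: all maximal isomorphisms between essential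
right ideals of `{a, b}*`. -/
def G21 : Type := {φ : Word ≃. Word // IsMaximalIso φ}

namespace G21

theorem comp_essential (φ ψ : G21) : IsEssentialIso (ψ.1.trans φ.1) :=
  ψ.2.toIsEssentialIso.trans φ.2.toIsEssentialIso

/-- `φ · ψ = max (φ ∘ ψ)`, where `ψ` is applied first. -/
noncomputable instance : Mul G21 :=
  ⟨fun φ ψ => ⟨maxExt (ψ.1.trans φ.1) (comp_essential φ ψ), maxExt_maximal _⟩⟩

/-- The identity map of `{a, b}*`. -/
instance : One G21 := ⟨⟨PEquiv.refl Word, refl_maximal⟩⟩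

/-- The inverse partial bijection. -/
instance : Inv G21 := ⟨fun φ => ⟨φ.1.symm, φ.2.symm⟩⟩

theorem comp_le_mul (φ ψ : G21) : ψ.1.trans φ.1 ≤ (φ * ψ).1 := le_maxExt (comp_essential φ ψ)

theorem eq_of_le {χ : Word ≃. Word} (hχ : IsEssentialIso χ) {φ ψ : G21} (h : χ ≤ φ.1)
    (h' : χ ≤ ψ.1) : φ = ψ :=
  Subtype.ext (eq_of_le_of_le hχ φ.2 ψ.2 h h')

noncomputable instance : Group G21 :=
  Group.ofLeftAxioms
    (by
      intro φ ψ χ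
      refine eq_of_le (χ := (χ.1.trans ψ.1).trans φ.1)
        ((comp_essential ψ χ).trans φ.2.toIsEssentialIso) ?_ ?_
      · rw [PEquiv.trans_assoc]
        exact (trans_le_trans le_rfl (comp_le_mul φ ψ)).trans (comp_le_mul (φ * ψ) χ)
      · exact (trans_le_trans (comp_le_mul ψ χ) le_rfl).trans (comp_le_mul φ (ψ * χ)))
    (by
      intro φ
      refine eq_of_le φ.2.toIsEssentialIso ?_ le_rfl
      have := comp_le_mul 1 φ
      rwa [show (1 : G21).1 = PEquiv.refl Word from rfl, PEquiv.trans_refl] at this)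
    (by
      intro φ
      refine eq_of_le (comp_essential φ⁻¹ φ) (comp_le_mul _ _) ?_
      intro u v hv
      rw [PEquiv.mem_trans] at hv
      obtain ⟨w, hw, hv⟩ := hv
      have : v = u := φ.1.inj ((PEquiv.mem_iff_mem φ.1).1 hv) hw
      rw [this]
      rfl)

end G21

/-- An essential right ideal is finitely generated iff it contains all sufficiently long words. -/
theorem isFinGen_iff {R : Set Word} (hR : IsEssential R) :
    IsFinGen R ↔ ∃ n : ℕ, ∀ u : Word, n ≤ u.length → u ∈ R := by
  constructor
  · rintro ⟨P, -, hfin, rfl⟩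
    obtain ⟨n, hn⟩ := (hfin.image List.length).bddAbove
    refine ⟨n, fun u hu => ?_⟩
    obtain ⟨x, p, hp, y, hxy⟩ := hR.exists_append u
    have hlen : p.length ≤ u.length := (hn ⟨p, hp, rfl⟩).trans hu
    obtain ⟨z, rfl⟩ := List.prefix_of_prefix_length_le ⟨y, hxy.symm⟩ ⟨x, rfl⟩ hlen
    exact ⟨p, hp, z, rfl⟩
  · rintro ⟨n, hn⟩
    refine ⟨{p | p ∈ R ∧ ∀ q ∈ R, q <+: p → q = p}, ?_, ?_, ?_⟩
    · rintro u ⟨hu, -⟩ v ⟨-, hv⟩ huv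
      exact hv u hu huv
    · refine (List.finite_length_le Letter n).subset ?_
      rintro p ⟨-, hp⟩
      by_contra hlen
      simp only [Set.mem_ofPred_eq, not_le] at hlen
      have h := hp (p.take n) (hn _ (by simp; omega)) (List.take_prefix n p)
      have := congrArg List.length h
      simp at this
      omega
    · ext w
      constructor
      · intro hw
        induction hl : w.length using Nat.strong_induction_on generalizing w with
        | _ l ih =>
          by_cases hmin : ∀ q ∈ R, q <+: w → q = w
          · exact ⟨w, ⟨hw, hmin⟩, [], by simp⟩
          · push Not at hmin
            obtain ⟨q, hq, ⟨z, rfl⟩, hne⟩ := hmin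
            have hz : z ≠ [] := by rintro rfl; simp at hne
            have hzl := List.length_pos_iff.2 hz
            obtain ⟨p, hp, x, hx⟩ := ih q.length (by simp at hl; omega) q hq rfl
            exact ⟨p, hp, x ++ z, by rw [hx, List.append_assoc]⟩
      · rintro ⟨p, ⟨hp, -⟩, x, rfl⟩
        exact hR.1 p hp x

theorem isFinGen_mono {R S : Set Word} (hR : IsEssential R) (hS : IsEssential S) (h : R ⊆ S)
    (hfin : IsFinGen R) : IsFinGen S := by
  rw [isFinGen_iff hR] at hfin
  rw [isFinGen_iff hS]
  obtain ⟨n, hn⟩ := hfin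
  exact ⟨n, fun u hu => h (hn u hu)⟩

theorem isFinGen_dom_trans {φ ψ : Word ≃. Word} (hφ : IsEssentialIso φ) (hψ : IsEssentialIso ψ)
    (h : IsFinGen (dom φ)) (h' : IsFinGen (dom ψ)) : IsFinGen (dom (φ.trans ψ)) := by
  rw [isFinGen_iff hφ.dom_essential] at h
  rw [isFinGen_iff hψ.dom_essential] at h'
  rw [isFinGen_iff (hφ.trans hψ).dom_essential]
  obtain ⟨n, hn⟩ := h
  obtain ⟨m, hm⟩ := h'
  refine ⟨n + m, fun u hu => ?_⟩
  obtain ⟨v, hv⟩ := hn (u.take n) (by simp; omega)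
  have hv' := hφ.map_append _ _ hv (u.drop n)
  rw [List.take_append_drop] at hv'
  obtain ⟨w, hw⟩ := hm (v ++ u.drop n) (by simp; omega)
  exact ⟨w, (PEquiv.mem_trans _ _ _ _).2 ⟨_, hv', hw⟩⟩

/-- The Thompson group `V`: the subgroup of `𝒢_{2,1}` of all maximal isomorphisms between finitely
generated essential right ideals of `{a, b}*`. -/
noncomputable def V : Subgroup G21 where
  carrier := {φ | IsFinGen (dom φ.1) ∧ IsFinGen (ran φ.1)}
  mul_mem' := by
    rintro φ ψ ⟨h1, h2⟩ ⟨h3, h4⟩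
    have hφ := φ.2.toIsEssentialIso
    have hψ := ψ.2.toIsEssentialIso
    have hle := G21.comp_le_mul φ ψ
    have hc := G21.comp_essential φ ψ
    refine ⟨isFinGen_mono hc.dom_essential (φ * ψ).2.dom_essential ?_
        (isFinGen_dom_trans hψ hφ h3 h1),
      isFinGen_mono hc.ran_essential (φ * ψ).2.ran_essential ?_ ?_⟩
    · rintro u ⟨v, hv⟩
      exact ⟨v, hle _ _ hv⟩
    · rintro v ⟨u, hv⟩
      exact ⟨u, hle _ _ hv⟩
    · rw [← dom_symm, PEquiv.symm_trans_rev]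
      exact isFinGen_dom_trans hφ.symm hψ.symm (by rwa [dom_symm]) (by rwa [dom_symm])
  one_mem' := by
    have h : IsFinGen Set.univ :=
      ⟨{[]}, by rintro u rfl v rfl -; rfl, Set.finite_singleton _, by
        ext w; simp [generatedBy]⟩
    have hdom : dom (PEquiv.refl Word) = Set.univ := by ext u; simp [dom]
    have hran : ran (PEquiv.refl Word) = Set.univ := by ext u; simp [ran]
    exact ⟨hdom ▸ h, hran ▸ h⟩
  inv_mem' := by
    rintro φ ⟨h1, h2⟩
    exact ⟨(dom_symm φ.1).symm ▸ h2, (ran_symm φ.1).symm ▸ h1⟩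

/-! ### The polycyclic monoid -/

/-- The polycyclic monoid `PC(a, b)` in normal form: its elements are `0` and the `y x⁻¹` with
`y, x ∈ A*`, where `pair y x` stands for `y x⁻¹`. -/
inductive PC
  | zero : PC
  | pair (y x : Word) : PC

namespace PC

instance : Zero PC := ⟨PC.zero⟩

/-- The identity is `ε ε⁻¹`. -/
instance : One PC := ⟨PC.pair [] []⟩

/-- `v u⁻¹ · t s⁻¹` is `v z s⁻¹` if `t = u z`, it is `v (s z)⁻¹` if `u = t z`, and it is `0` if
`u` and `t` are not prefix-comparable. -/
instance : Mul PC :=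
  ⟨fun p q => match p, q with
    | pair v u, pair t s =>
      if u <+: t then pair (v ++ t.drop u.length) s
      else if t <+: u then pair v (s ++ u.drop t.length)
      else zero
    | _, _ => zero⟩

theorem zero_mul' (p : PC) : 0 * p = 0 := rfl

theorem mul_zero' (p : PC) : p * 0 = 0 := by cases p <;> rfl

theorem pair_mul_pair (v u t s : Word) : pair v u * pair t s =
    if u <+: t then pair (v ++ t.drop u.length) s
    else if t <+: u then pair v (s ++ u.drop t.length) else 0 := rfl

theorem pair_ne_zero (y x : Word) : pair y x ≠ 0 := PC.noConfusion

/-- `y x⁻¹` as a relation on `A*`: it relates `x z` to `y z`. -/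
def Graph : PC → Word → Word → Prop
  | zero, _, _ => False
  | pair y x, w, c => ∃ z, w = x ++ z ∧ c = y ++ z

theorem graph_mul (p q : PC) (w c : Word) :
    Graph (p * q) w c ↔ ∃ m, Graph q w m ∧ Graph p m c := by
  rcases p with _ | ⟨v, u⟩
  · exact ⟨fun h => h.elim, fun ⟨m, _, h⟩ => h⟩
  rcases q with _ | ⟨t, s⟩
  · exact ⟨fun h => h.elim, fun ⟨m, h, _⟩ => h⟩
  rw [pair_mul_pair]
  by_cases h1 : u <+: t
  · rw [if_pos h1]
    obtain ⟨r, rfl⟩ := h1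
    simp only [Graph, List.drop_left]
    constructor
    · rintro ⟨z, rfl, rfl⟩
      exact ⟨u ++ r ++ z, ⟨z, rfl, rfl⟩, r ++ z, by simp, by simp⟩
    · rintro ⟨m, ⟨z, rfl, rfl⟩, z', h, rfl⟩
      rw [List.append_assoc, List.append_cancel_left_eq] at h
      exact ⟨z, rfl, by simp [← h]⟩
  · rw [if_neg h1]
    by_cases h2 : t <+: u
    · rw [if_pos h2]
      obtain ⟨r, rfl⟩ := h2
      simp only [Graph, List.drop_left]
      constructor
      · rintro ⟨z, rfl, rfl⟩
        exact ⟨t ++ r ++ z, ⟨r ++ z, by simp, by simp⟩, z, by simp, by simp⟩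
      · rintro ⟨m, ⟨z, rfl, rfl⟩, z', h, rfl⟩
        rw [List.append_assoc, List.append_cancel_left_eq] at h
        exact ⟨z', by simp [h], rfl⟩
    · rw [if_neg h2]
      refine ⟨fun h => h.elim, ?_⟩
      rintro ⟨m, ⟨z, rfl, rfl⟩, z', h, rfl⟩
      rcases List.prefix_or_prefix_of_prefix (l₁ := u) (l₂ := t) (l₃ := t ++ z) ⟨z', h.symm⟩
        ⟨z, rfl⟩ with h | h
      · exact h1 h
      · exact h2 h

theorem graph_injective {p q : PC} (h : ∀ w c, Graph p w c ↔ Graph q w c) : p = q := by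
  rcases p with _ | ⟨y, x⟩ <;> rcases q with _ | ⟨y', x'⟩
  · rfl
  · exact ((h x' y').2 ⟨[], by simp, by simp⟩).elim
  · exact ((h x y).1 ⟨[], by simp, by simp⟩).elim
  · obtain ⟨z, hx, hy⟩ := (h x y).1 ⟨[], by simp, by simp⟩
    obtain ⟨z', hx', hy'⟩ := (h x' y').2 ⟨[], by simp, by simp⟩
    have hz : z = [] := by
      have := congrArg List.length hx
      have h2 := congrArg List.length hx'
      simp at this h2
      exact List.length_eq_zero_iff.1 (by omega)
    subst hz
    simp at hx hy
    rw [hx, hy]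

instance : MonoidWithZero PC where
  mul_assoc p q r := by
    refine graph_injective fun w c => ?_
    simp only [graph_mul]
    constructor
    · rintro ⟨m, h1, n, h2, h3⟩
      exact ⟨n, ⟨m, h1, h2⟩, h3⟩
    · rintro ⟨n, ⟨m, h1, h2⟩, h3⟩
      exact ⟨m, h1, n, h2, h3⟩
  one_mul p := by
    refine graph_injective fun w c => ?_
    rw [graph_mul]
    constructor
    · rintro ⟨m, h, z, rfl, rfl⟩
      exact h
    · exact fun h => ⟨c, h, c, rfl, rfl⟩
  mul_one p := by
    refine graph_injective fun w c => ?_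
    rw [graph_mul]
    constructor
    · rintro ⟨m, ⟨z, rfl, rfl⟩, h⟩
      exact h
    · exact fun h => ⟨w, ⟨w, rfl, rfl⟩, h⟩
  zero_mul := zero_mul'
  mul_zero := mul_zero'

/-- The word `y`, as an element of `PC(a, b)`. -/
def word (y : Word) : PC := pair y []

/-- The inverse `x⁻¹` of the word `x`, as an element of `PC(a, b)`. -/
def wordInv (x : Word) : PC := pair [] x

theorem word_mul_wordInv (y x : Word) : word y * wordInv x = pair y x := by
  simp [word, wordInv, pair_mul_pair]

theorem word_append (y z : Word) : word (y ++ z) = word y * word z := by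
  simp [word, pair_mul_pair]

theorem wordInv_append (y z : Word) : wordInv (y ++ z) = wordInv z * wordInv y := by
  simp only [wordInv, pair_mul_pair, List.nil_append, List.length_nil, List.drop_zero,
    List.nil_prefix, if_true]
  split_ifs with h
  · rw [List.prefix_nil.1 h]; simp
  · rfl

/-- The defining relations: `α⁻¹ α = 1`, and `α⁻¹ β = 0` for letters `α ≠ β`. -/
theorem relations (α β : Letter) : wordInv [α] * word [β] = if α = β then 1 else 0 := by
  simp only [wordInv, word, pair_mul_pair]
  by_cases h : α = β
  · subst h; simp; rfl
  · have h' : β ≠ α := fun e => h e.symm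
    simp [h, h']

/-- `PC(a, b)` is an inverse monoid, and the inverse of `y x⁻¹` is `x y⁻¹`. -/
theorem existsUnique_inverse (p : PC) : ∃! q : PC, p * q * p = p ∧ q * p * q = q := by
  have hinj : ∀ {p : PC} {w w' c : Word}, Graph p w c → Graph p w' c → w = w' := by
    rintro (_ | ⟨y, x⟩) w w' c h h'
    · exact h.elim
    · obtain ⟨z, rfl, rfl⟩ := h
      obtain ⟨z', rfl, h⟩ := h'
      rw [List.append_cancel_left h]
  have hfun : ∀ {p : PC} {w c c' : Word}, Graph p w c → Graph p w c' → c = c' := by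
    rintro (_ | ⟨y, x⟩) w c c' h h'
    · exact h.elim
    · obtain ⟨z, rfl, rfl⟩ := h
      obtain ⟨z', h, rfl⟩ := h'
      rw [List.append_cancel_left h]
  have hconv : ∀ {p q : PC}, p * q * p = p → ∀ {w c : Word}, Graph p w c → Graph q c w := by
    intro p q h w c hg
    have hg' := hg
    rw [← h, graph_mul] at hg'
    obtain ⟨m, h1, h2⟩ := hg'
    rw [graph_mul] at h2
    obtain ⟨n, h3, h4⟩ := h2
    rwa [hfun h1 hg, hinj h4 hg] at h3
  have hq : ∃ q : PC, p * q * p = p ∧ q * p * q = q := by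
    rcases p with _ | ⟨y, x⟩
    · exact ⟨0, rfl, rfl⟩
    · exact ⟨pair x y, by simp [pair_mul_pair], by simp [pair_mul_pair]⟩
  obtain ⟨q, h1, h2⟩ := hq
  refine ⟨q, ⟨h1, h2⟩, ?_⟩
  rintro q' ⟨h3, h4⟩
  exact graph_injective fun w c => ⟨fun h => hconv h1 (hconv h4 h), fun h => hconv h3 (hconv h2 h)⟩

/-- `PC(a, b)` is presented by its defining relations: two maps `f, g` from the letters to a monoid
with zero that satisfy `g α * f α = 1`, and `g α * f β = 0` for `α ≠ β`, extend in exactly one way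
to a homomorphism. -/
theorem existsUnique_lift {M : Type*} [MonoidWithZero M] (f g : Letter → M)
    (h : ∀ α β, g α * f β = if α = β then 1 else 0) :
    ∃! F : PC →*₀ M, (∀ α, F (word [α]) = f α) ∧ ∀ α, F (wordInv [α]) = g α := by
  have hcancel : ∀ u : Word, (u.reverse.map g).prod * (u.map f).prod = 1 := by
    intro u
    induction u with
    | nil => simp
    | cons α u ih =>
      simp only [List.reverse_cons, List.map_append, List.prod_append, List.map_cons,
        List.map_nil, List.prod_cons, List.prod_nil, mul_one]
      rw [mul_assoc, ← mul_assoc (g α), h, if_pos rfl, one_mul, ih]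
  have hzero : ∀ u t : Word, ¬ u <+: t → ¬ t <+: u →
      (u.reverse.map g).prod * (t.map f).prod = 0 := by
    intro u
    induction u with
    | nil => intro t h1; exact (h1 t.nil_prefix).elim
    | cons α u ih =>
      intro t h1 h2
      cases t with
      | nil => exact (h2 (List.nil_prefix)).elim
      | cons β t =>
        simp only [List.reverse_cons, List.map_append, List.prod_append, List.map_cons,
          List.map_nil, List.prod_cons, List.prod_nil, mul_one]
        rw [mul_assoc, ← mul_assoc (g α), h]
        by_cases hαβ : α = β
        · subst hαβ
          rw [if_pos rfl, one_mul]
          exact ih t (fun e => h1 (by simpa using e)) (fun e => h2 (by simpa using e))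
        · rw [if_neg hαβ, zero_mul, mul_zero]
  let F : PC →*₀ M :=
    { toFun := fun p => match p with
        | zero => 0
        | pair y x => (y.map f).prod * (x.reverse.map g).prod
      map_zero' := rfl
      map_one' := by change (List.map f []).prod * _ = 1; simp
      map_mul' := by
        rintro (_ | ⟨v, u⟩) (_ | ⟨t, s⟩)
        · exact (zero_mul _).symm
        · exact (zero_mul _).symm
        · exact (mul_zero _).symm
        · rw [pair_mul_pair]
          change _ = (v.map f).prod * (u.reverse.map g).prod *
            ((t.map f).prod * (s.reverse.map g).prod)
          rw [mul_assoc, ← mul_assoc (u.reverse.map g).prod]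
          split_ifs with h1 h2
          · obtain ⟨r, rfl⟩ := h1
            rw [List.map_append, List.prod_append, ← mul_assoc _ (u.map f).prod, hcancel]
            simp [mul_assoc]
          · obtain ⟨r, rfl⟩ := h2
            rw [List.reverse_append, List.map_append, List.prod_append, mul_assoc _ _ (t.map f).prod,
              hcancel]
            simp
          · rw [hzero u t h1 h2, zero_mul, mul_zero] }
  have hFw : ∀ α, F (word [α]) = f α := fun α => by
    change (List.map f [α]).prod * (List.map g ([] : Word).reverse).prod = f α
    simp
  have hFi : ∀ α, F (wordInv [α]) = g α := fun α => by
    change (List.map f []).prod * (List.map g [α].reverse).prod = g α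
    simp
  refine ⟨F, ⟨hFw, hFi⟩, ?_⟩
  rintro G ⟨hGw, hGi⟩
  have hw : ∀ y : Word, G (word y) = F (word y) := by
    intro y
    induction y with
    | nil => exact (map_one G).trans (map_one F).symm
    | cons α y ih =>
      rw [show α :: y = [α] ++ y from rfl, word_append, map_mul, map_mul, ih, hGw, hFw]
  have hi : ∀ x : Word, G (wordInv x) = F (wordInv x) := by
    intro x
    induction x with
    | nil => exact (map_one G).trans (map_one F).symm
    | cons α x ih =>
      rw [show α :: x = [α] ++ x from rfl, wordInv_append, map_mul, map_mul, ih, hGi, hFi]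
  ext p
  rcases p with _ | ⟨y, x⟩
  · exact (map_zero G).trans (map_zero F).symm
  · rw [← word_mul_wordInv, map_mul, map_mul, hw, hi]

end PC

/-! ### The algebra `𝒞_V = K[PC(a, b)] / I_V` -/

section AlgebraV

variable (K : Type*) [Field K]

/-- `K[PC(a, b)]`: the algebra of the finite sums `∑ κᵢ yᵢ xᵢ⁻¹`, that is, the monoid algebra of
`PC(a, b)` in which the zero of the monoid is identified with the zero of the algebra. -/
abbrev KPC : Type _ :=
  (TwoSidedIdeal.span {MonoidAlgebra.single (0 : PC) (1 : K)}).ringCon.Quotient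

/-- The element `y x⁻¹` of `K[PC(a, b)]`. -/
noncomputable def kpair (y x : Word) : KPC K :=
  RingCon.mk' _ (MonoidAlgebra.single (PC.pair y x) (1 : K))

/-- The ideal `I_V` generated by `a a⁻¹ + b b⁻¹ - 1`. -/
noncomputable def IV : TwoSidedIdeal (KPC K) :=
  TwoSidedIdeal.span {kpair K [Letter.a] [Letter.a] + kpair K [Letter.b] [Letter.b] - 1}

/-- `𝒞_V = K[PC(a, b)] / I_V`. -/
abbrev CV : Type _ := (IV K).ringCon.Quotient

/-- The set `𝒰_V` of unary sums `∑_{i ∈ I} yᵢ xᵢ⁻¹` with finite index set `I`: both `i ↦ xᵢ` and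
`i ↦ yᵢ` are bijections from `I` onto a maximal prefix code. -/
def UV : Set (KPC K) :=
  {s | ∃ (I : Finset ℕ) (x y : I → Word), Function.Injective x ∧ Function.Injective y ∧
    IsMaximalPrefixCode (Set.range x) ∧ IsMaximalPrefixCode (Set.range y) ∧
    s = ∑ i, kpair K (y i) (x i)}

/-- `𝒰_V / I_V`: the set of the classes of the elements of `𝒰_V` in `𝒞_V`. -/
def UVmodIV : Set (CV K) := (IV K).ringCon.mk' '' UV K

end AlgebraV

/-! ### The algebra `ℬ_∞` of finite-to-finite infinite sums -/

/-- A relation between words is finite-to-finite: each word is related to finitely many words, on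
either side. -/
def FiniteToFinite (S : Set (Word × Word)) : Prop :=
  (∀ y : Word, {x : Word | (y, x) ∈ S}.Finite) ∧ ∀ x : Word, {y : Word | (y, x) ∈ S}.Finite

theorem FiniteToFinite.mono {S T : Set (Word × Word)} (hT : FiniteToFinite T) (h : S ⊆ T) :
    FiniteToFinite S :=
  ⟨fun y => (hT.1 y).subset fun _ hx => h hx, fun x => (hT.2 x).subset fun _ hy => h hy⟩

theorem FiniteToFinite.union {S T : Set (Word × Word)} (hS : FiniteToFinite S)
    (hT : FiniteToFinite T) : FiniteToFinite (S ∪ T) :=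
  ⟨fun y => ((hS.1 y).union (hT.1 y)).subset fun _ hx => hx,
    fun x => ((hS.2 x).union (hT.2 x)).subset fun _ hy => hy⟩

theorem FiniteToFinite.swap {S : Set (Word × Word)} (hS : FiniteToFinite S) :
    FiniteToFinite (Prod.swap ⁻¹' S) := ⟨hS.2, hS.1⟩

/-- The element `y x⁻¹` of `PC(a, b)` that belongs to the pair `(y, x)`. -/
def toPC (p : Word × Word) : PC := PC.pair p.1 p.2

theorem toPC_injective : Function.Injective toPC := by
  rintro ⟨y, x⟩ ⟨y', x'⟩ h
  simpa [toPC] using h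

theorem toPC_swap_mul {p q m : Word × Word} (h : toPC p * toPC q = toPC m) :
    toPC q.swap * toPC p.swap = toPC m.swap := by
  have hg : ∀ (p : Word × Word) (w c : Word),
      PC.Graph (toPC p.swap) w c ↔ PC.Graph (toPC p) c w := by
    rintro ⟨y, x⟩ w c
    exact ⟨fun ⟨z, h1, h2⟩ => ⟨z, h2, h1⟩, fun ⟨z, h1, h2⟩ => ⟨z, h2, h1⟩⟩
  refine PC.graph_injective fun w c => ?_
  rw [hg, ← h, PC.graph_mul, PC.graph_mul]
  simp only [hg]
  exact ⟨fun ⟨m, h1, h2⟩ => ⟨m, h2, h1⟩, fun ⟨m, h1, h2⟩ => ⟨m, h2, h1⟩⟩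

theorem finite_factorizations_left {S T : Set (Word × Word)} (hS : FiniteToFinite S)
    (hT : FiniteToFinite T) (y : Word) :
    {z : (Word × Word) × (Word × Word) | z.1 ∈ S ∧ z.2 ∈ T ∧
      ∃ x, toPC z.1 * toPC z.2 = toPC (y, x)}.Finite := by
  have hpre : ∀ w : Word, {v : Word | v <+: w}.Finite := fun w =>
    (List.finite_toSet w.inits).subset fun v hv => (List.mem_inits v w).2 hv
  have hfin : (⋃ v ∈ {v : Word | v <+: y}, ⋃ u ∈ {u : Word | (v, u) ∈ S},
      ⋃ t ∈ insert (u ++ y.drop v.length) {t : Word | t <+: u}, ⋃ s ∈ {s : Word | (t, s) ∈ T},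
      ({((v, u), (t, s))} : Set ((Word × Word) × (Word × Word)))).Finite := by
    refine (hpre y).biUnion fun v _ => (hS.1 v).biUnion fun u _ => ?_
    refine ((hpre u).insert _).biUnion fun t _ => (hT.1 t).biUnion fun s _ => ?_
    exact Set.finite_singleton _
  refine hfin.subset ?_
  rintro ⟨⟨v, u⟩, ⟨t, s⟩⟩ ⟨h1, h2, x, h⟩
  simp only [Set.mem_iUnion]
  rw [toPC, toPC, toPC, PC.pair_mul_pair] at h
  dsimp only at h h1 h2
  split_ifs at h with h3 h4
  · obtain ⟨r, rfl⟩ := h3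
    injection h with hy hx
    rw [List.drop_left] at hy
    subst hy
    exact ⟨v, ⟨r, rfl⟩, u, h1, u ++ r, by simp, s, h2, rfl⟩
  · injection h with hy hx
    subst hy
    exact ⟨v, List.prefix_refl v, u, h1, t, Or.inr h4, s, h2, rfl⟩

theorem finite_factorizations_right {S T : Set (Word × Word)} (hS : FiniteToFinite S)
    (hT : FiniteToFinite T) (x : Word) :
    {z : (Word × Word) × (Word × Word) | z.1 ∈ S ∧ z.2 ∈ T ∧
      ∃ y, toPC z.1 * toPC z.2 = toPC (y, x)}.Finite := by
  refine ((finite_factorizations_left hT.swap hS.swap x).image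
    fun z => (z.2.swap, z.1.swap)).subset ?_
  rintro ⟨p, q⟩ ⟨h1, h2, y, h⟩
  exact ⟨(q.swap, p.swap), ⟨by simpa using h2, by simpa using h1, y, toPC_swap_mul h⟩, rfl⟩

theorem finite_factorizations {S T : Set (Word × Word)} (hS : FiniteToFinite S)
    (hT : FiniteToFinite T) (p : Word × Word) :
    {z : (Word × Word) × (Word × Word) | z.1 ∈ S ∧ z.2 ∈ T ∧
      toPC z.1 * toPC z.2 = toPC p}.Finite :=
  (finite_factorizations_left hS hT p.1).subset fun _ hz => ⟨hz.1, hz.2.1, p.2, hz.2.2⟩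

/-- The set of the products of the elements of `S` with those of `T`, without `0`. -/
def mulRel (S T : Set (Word × Word)) : Set (Word × Word) :=
  {p | ∃ q ∈ S, ∃ r ∈ T, toPC q * toPC r = toPC p}

theorem FiniteToFinite.mulRel {S T : Set (Word × Word)} (hS : FiniteToFinite S)
    (hT : FiniteToFinite T) : FiniteToFinite (mulRel S T) := by
  have hfin : ∀ z : (Word × Word) × (Word × Word), {p | toPC z.1 * toPC z.2 = toPC p}.Finite :=
    fun z => Set.Subsingleton.finite fun p hp q hq => toPC_injective (hp.symm.trans hq)
  constructor
  · intro y
    refine (((finite_factorizations_left hS hT y).biUnion fun z _ => hfin z).image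
      Prod.snd).subset ?_
    rintro x ⟨q, hq, r, hr, h⟩
    exact ⟨(y, x), Set.mem_biUnion (x := (q, r)) ⟨hq, hr, x, h⟩ h, rfl⟩
  · intro x
    refine (((finite_factorizations_right hS hT x).biUnion fun z _ => hfin z).image
      Prod.fst).subset ?_
    rintro y ⟨q, hq, r, hr, h⟩
    exact ⟨(y, x), Set.mem_biUnion (x := (q, r)) ⟨hq, hr, y, h⟩ h, rfl⟩

section AlgebraB

variable (K : Type*) [Field K]

/-- The coefficient functions of the elements of `ℬ_∞`. -/
def BInfSubmodule : Submodule K (Word × Word → K) where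
  carrier := {s | FiniteToFinite (Function.support s)}
  add_mem' := fun {s t} hs ht =>
    (FiniteToFinite.union hs ht).mono (Function.support_add s t)
  zero_mem' := by
    change FiniteToFinite (Function.support (0 : Word × Word → K))
    rw [Function.support_zero]
    exact ⟨fun _ => Set.finite_empty, fun _ => Set.finite_empty⟩
  smul_mem' := fun c s hs => FiniteToFinite.mono hs (Function.support_const_smul_subset c s)

/-- `ℬ_∞`: the possibly infinite formal sums `∑ κᵢ yᵢ xᵢ⁻¹` for which the relation of all the pairs
`(yᵢ, xᵢ)` is finite-to-finite. Such a sum is given by its coefficients: the value of the function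
at `(y, x)` is the coefficient of `y x⁻¹`. -/
def BInf : Type _ := BInfSubmodule K

noncomputable instance : AddCommGroup (BInf K) := inferInstanceAs (AddCommGroup (BInfSubmodule K))

noncomputable instance : Module K (BInf K) := inferInstanceAs (Module K (BInfSubmodule K))

namespace BInf

variable {K}

/-- The coefficient of `y x⁻¹`, where `p = (y, x)`. -/
def coeff (s : BInf K) (p : Word × Word) : K := s.1 p

theorem finiteToFinite (s : BInf K) : FiniteToFinite (Function.support s.coeff) := s.2

@[ext] theorem ext {s t : BInf K} (h : ∀ p, s.coeff p = t.coeff p) : s = t :=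
  Subtype.ext (funext h)

theorem coeff_add (s t : BInf K) (p : Word × Word) : (s + t).coeff p = s.coeff p + t.coeff p := rfl

theorem coeff_zero (p : Word × Word) : (0 : BInf K).coeff p = 0 := rfl

theorem coeff_neg (s : BInf K) (p : Word × Word) : (-s).coeff p = -s.coeff p := rfl

theorem coeff_sub (s t : BInf K) (p : Word × Word) : (s - t).coeff p = s.coeff p - t.coeff p := rfl

theorem coeff_smul (c : K) (s : BInf K) (p : Word × Word) : (c • s).coeff p = c * s.coeff p := rfl

open Classical in
/-- The coefficient of the product `s t` at `p`: the sum of all the `s_q t_r` with `q r = p` in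
`PC(a, b)`. Only finitely many of these are nonzero. -/
noncomputable def mulCoeff (s t : BInf K) (p : Word × Word) : K :=
  ∑ᶠ z : (Word × Word) × (Word × Word),
    if toPC z.1 * toPC z.2 = toPC p then s.coeff z.1 * t.coeff z.2 else 0

open Classical in
theorem mulCoeff_finite (s t : BInf K) (p : Word × Word) :
    (Function.support fun z : (Word × Word) × (Word × Word) =>
      if toPC z.1 * toPC z.2 = toPC p then s.coeff z.1 * t.coeff z.2 else 0).Finite := by
  refine (finite_factorizations s.finiteToFinite t.finiteToFinite p).subset fun z hz => ?_
  rw [Function.mem_support, ne_eq, ite_eq_right_iff, Classical.not_imp] at hz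
  exact ⟨left_ne_zero_of_mul hz.2, right_ne_zero_of_mul hz.2, hz.1⟩

theorem support_mulCoeff (s t : BInf K) :
    Function.support (mulCoeff s t) ⊆
      mulRel (Function.support s.coeff) (Function.support t.coeff) := by
  classical
  intro p hp
  obtain ⟨z, hz⟩ : ∃ z : (Word × Word) × (Word × Word),
      (if toPC z.1 * toPC z.2 = toPC p then s.coeff z.1 * t.coeff z.2 else 0) ≠ 0 := by
    by_contra hc
    push Not at hc
    exact hp (finsum_eq_zero_of_forall_eq_zero hc)
  rw [ne_eq, ite_eq_right_iff, Classical.not_imp] at hz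
  exact ⟨z.1, left_ne_zero_of_mul hz.2, z.2, right_ne_zero_of_mul hz.2, hz.1⟩

noncomputable instance : Mul (BInf K) :=
  ⟨fun s t => ⟨mulCoeff s t,
    (s.finiteToFinite.mulRel t.finiteToFinite).mono (support_mulCoeff s t)⟩⟩

theorem coeff_mul (s t : BInf K) (p : Word × Word) : (s * t).coeff p = mulCoeff s t p := rfl

open Classical in
/-- The sum `y x⁻¹` with a single term, with coefficient `1`. -/
noncomputable def mono (y x : Word) : BInf K :=
  ⟨fun p => if p = (y, x) then 1 else 0, by
    constructor
    · intro v
      refine (Set.finite_singleton x).subset fun u hu => ?_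
      have h : (v, u) = (y, x) := by by_contra h; exact hu (if_neg h)
      exact congrArg Prod.snd h
    · intro u
      refine (Set.finite_singleton y).subset fun v hv => ?_
      have h : (v, u) = (y, x) := by by_contra h; exact hv (if_neg h)
      exact congrArg Prod.fst h⟩

open Classical in
theorem coeff_mono (y x : Word) (p : Word × Word) :
    (mono y x : BInf K).coeff p = if p = (y, x) then 1 else 0 := rfl

noncomputable instance : One (BInf K) := ⟨mono [] []⟩

theorem toPC_nil : toPC ([], []) = 1 := rfl

theorem one_mul' (s : BInf K) : 1 * s = s := by
  classical
  ext p
  rw [coeff_mul, mulCoeff, finsum_eq_single _ (([], []), p)]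
  · rw [toPC_nil, one_mul, if_pos rfl]
    change (mono [] [] : BInf K).coeff _ * _ = _
    rw [coeff_mono, if_pos rfl, one_mul]
  · rintro ⟨q, r⟩ hne
    split_ifs with h
    · change (mono [] [] : BInf K).coeff q * _ = 0
      rw [coeff_mono, if_neg, zero_mul]
      rintro rfl
      rw [toPC_nil, one_mul] at h
      exact hne (Prod.ext rfl (toPC_injective h))
    · rfl

theorem mul_one' (s : BInf K) : s * 1 = s := by
  classical
  ext p
  rw [coeff_mul, mulCoeff, finsum_eq_single _ (p, ([], []))]
  · rw [toPC_nil, mul_one, if_pos rfl]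
    change _ * (mono [] [] : BInf K).coeff _ = _
    rw [coeff_mono, if_pos rfl, mul_one]
  · rintro ⟨q, r⟩ hne
    split_ifs with h
    · change _ * (mono [] [] : BInf K).coeff r = 0
      rw [coeff_mono, if_neg, mul_zero]
      rintro rfl
      rw [toPC_nil, mul_one] at h
      exact hne (Prod.ext (toPC_injective h) rfl)
    · rfl

theorem left_distrib' (s t u : BInf K) : s * (t + u) = s * t + s * u := by
  classical
  ext p
  rw [coeff_add, coeff_mul, coeff_mul, coeff_mul, mulCoeff, mulCoeff, mulCoeff,
    ← finsum_add_distrib (mulCoeff_finite s t p) (mulCoeff_finite s u p)]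
  refine finsum_congr fun z => ?_
  split_ifs
  · rw [coeff_add, mul_add]
  · rw [add_zero]

theorem right_distrib' (s t u : BInf K) : (s + t) * u = s * u + t * u := by
  classical
  ext p
  rw [coeff_add, coeff_mul, coeff_mul, coeff_mul, mulCoeff, mulCoeff, mulCoeff,
    ← finsum_add_distrib (mulCoeff_finite s u p) (mulCoeff_finite t u p)]
  refine finsum_congr fun z => ?_
  split_ifs
  · rw [coeff_add, add_mul]
  · rw [add_zero]

theorem smul_mul' (c : K) (s t : BInf K) : c • s * t = c • (s * t) := by
  classical
  ext p
  rw [coeff_smul, coeff_mul, coeff_mul, mulCoeff, mulCoeff, mul_finsum]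
  refine finsum_congr fun z => ?_
  rw [coeff_smul, mul_ite, mul_zero, mul_assoc]

theorem mul_smul' (c : K) (s t : BInf K) : s * c • t = c • (s * t) := by
  classical
  ext p
  rw [coeff_smul, coeff_mul, coeff_mul, mulCoeff, mulCoeff, mul_finsum]
  refine finsum_congr fun z => ?_
  rw [coeff_smul, mul_ite, mul_zero, mul_left_comm]

theorem mul_assoc' (s t u : BInf K) : s * t * u = s * (t * u) := by
  classical
  ext p
  let T : Set ((Word × Word) × (Word × Word) × (Word × Word)) :=
    {z | z.1 ∈ Function.support s.coeff ∧ z.2.1 ∈ Function.support t.coeff ∧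
      z.2.2 ∈ Function.support u.coeff ∧ toPC z.1 * toPC z.2.1 * toPC z.2.2 = toPC p}
  let g : (Word × Word) × (Word × Word) × (Word × Word) → K := fun z =>
    if toPC z.1 * toPC z.2.1 * toPC z.2.2 = toPC p
      then s.coeff z.1 * t.coeff z.2.1 * u.coeff z.2.2 else 0
  have hex : ∀ q r l : PC, ∀ m : Word × Word, q * r * l = toPC m → ∃ n, q * r = toPC n := by
    intro q r l m h
    rcases hn : q * r with _ | ⟨y, x⟩
    · rw [hn] at h
      exact (PC.pair_ne_zero _ _ h.symm).elim
    · exact ⟨(y, x), rfl⟩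
  have hex' : ∀ q r l : PC, ∀ m : Word × Word, q * (r * l) = toPC m → ∃ n, r * l = toPC n := by
    intro q r l m h
    rcases hn : r * l with _ | ⟨y, x⟩
    · rw [hn] at h
      change q * 0 = _ at h
      rw [mul_zero] at h
      exact (PC.pair_ne_zero _ _ h.symm).elim
    · exact ⟨(y, x), rfl⟩
  -- both sides are the sum of `g` over all triples
  have hL : (s * t * u).coeff p = ∑ᶠ z, g z := by
    let F : ((Word × Word) × (Word × Word)) × ((Word × Word) × (Word × Word)) → K := fun z =>
      if toPC z.1.1 * toPC z.1.2 = toPC p ∧ toPC z.2.1 * toPC z.2.2 = toPC z.1.1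
        then s.coeff z.2.1 * t.coeff z.2.2 * u.coeff z.1.2 else 0
    have hF : (Function.support F).Finite := by
      have hfin := (finite_factorizations (s.finiteToFinite.mulRel t.finiteToFinite)
        u.finiteToFinite p).biUnion fun z _ =>
          (finite_factorizations s.finiteToFinite t.finiteToFinite z.1).image fun w => (z, w)
      refine hfin.subset ?_
      rintro ⟨⟨m, l⟩, ⟨q, r⟩⟩ hz
      rw [Function.mem_support, ne_eq, ite_eq_right_iff, Classical.not_imp] at hz
      obtain ⟨⟨h1, h2⟩, h3⟩ := hz
      have hu := right_ne_zero_of_mul h3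
      have hs := left_ne_zero_of_mul (left_ne_zero_of_mul h3)
      have ht := right_ne_zero_of_mul (left_ne_zero_of_mul h3)
      exact Set.mem_biUnion (x := (m, l)) ⟨⟨q, hs, r, ht, h2⟩, hu, h1⟩
        ⟨(q, r), ⟨hs, ht, h2⟩, rfl⟩
    let e : ((Word × Word) × (Word × Word) × (Word × Word)) × (Word × Word) ≃
        ((Word × Word) × (Word × Word)) × ((Word × Word) × (Word × Word)) :=
      { toFun := fun z => ((z.2, z.1.2.2), (z.1.1, z.1.2.1))
        invFun := fun z => ((z.2.1, z.2.2, z.1.2), z.1.1)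
        left_inv := fun _ => rfl
        right_inv := fun _ => rfl }
    have h1 : (s * t * u).coeff p = ∑ᶠ z, F z := by
      rw [finsum_curry F hF, coeff_mul, mulCoeff]
      refine finsum_congr fun z => ?_
      rw [coeff_mul, mulCoeff, finsum_mul]
      split_ifs with h
      · refine finsum_congr fun w => ?_
        simp only [F, h, true_and, ite_mul, zero_mul]
      · simp only [F, h, false_and, if_false, finsum_zero]
    have hF' : (Function.support fun z => F (e z)).Finite :=
      (hF.preimage e.injective.injOn).subset fun z hz => hz
    rw [h1, ← finsum_comp_equiv e, finsum_curry _ hF']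
    refine finsum_congr fun z => ?_
    by_cases h : toPC z.1 * toPC z.2.1 * toPC z.2.2 = toPC p
    · obtain ⟨n, hn⟩ := hex _ _ _ _ h
      rw [finsum_eq_single _ n]
      · have h' := h
        rw [hn] at h'
        simp only [F, g, e, Equiv.coe_fn_mk, h', hn, and_self, if_true]
      · intro m hm
        simp only [F, e, Equiv.coe_fn_mk]
        exact if_neg fun hc => hm (toPC_injective (hc.2.symm.trans hn))
    · simp only [g, if_neg h]
      refine finsum_eq_zero_of_forall_eq_zero fun m => if_neg ?_
      rintro ⟨h1, h2⟩
      simp only [e, Equiv.coe_fn_mk] at h1 h2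
      exact h (by rw [h2, h1])
  have hR : (s * (t * u)).coeff p = ∑ᶠ z, g z := by
    let F : ((Word × Word) × (Word × Word)) × ((Word × Word) × (Word × Word)) → K := fun z =>
      if toPC z.1.1 * toPC z.1.2 = toPC p ∧ toPC z.2.1 * toPC z.2.2 = toPC z.1.2
        then s.coeff z.1.1 * (t.coeff z.2.1 * u.coeff z.2.2) else 0
    have hF : (Function.support F).Finite := by
      have hfin := (finite_factorizations s.finiteToFinite
        (t.finiteToFinite.mulRel u.finiteToFinite) p).biUnion fun z _ =>
          (finite_factorizations t.finiteToFinite u.finiteToFinite z.2).image fun w => (z, w)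
      refine hfin.subset ?_
      rintro ⟨⟨q, m⟩, ⟨r, l⟩⟩ hz
      rw [Function.mem_support, ne_eq, ite_eq_right_iff, Classical.not_imp] at hz
      obtain ⟨⟨h1, h2⟩, h3⟩ := hz
      have hs := left_ne_zero_of_mul h3
      have ht := left_ne_zero_of_mul (right_ne_zero_of_mul h3)
      have hu := right_ne_zero_of_mul (right_ne_zero_of_mul h3)
      exact Set.mem_biUnion (x := (q, m)) ⟨hs, ⟨r, ht, l, hu, h2⟩, h1⟩
        ⟨(r, l), ⟨ht, hu, h2⟩, rfl⟩
    let e : ((Word × Word) × (Word × Word) × (Word × Word)) × (Word × Word) ≃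
        ((Word × Word) × (Word × Word)) × ((Word × Word) × (Word × Word)) :=
      { toFun := fun z => ((z.1.1, z.2), (z.1.2.1, z.1.2.2))
        invFun := fun z => ((z.1.1, z.2.1, z.2.2), z.1.2)
        left_inv := fun _ => rfl
        right_inv := fun _ => rfl }
    have h1 : (s * (t * u)).coeff p = ∑ᶠ z, F z := by
      rw [finsum_curry F hF, coeff_mul, mulCoeff]
      refine finsum_congr fun z => ?_
      rw [coeff_mul, mulCoeff, mul_finsum]
      split_ifs with h
      · refine finsum_congr fun w => ?_
        simp only [F, h, true_and, mul_ite, mul_zero]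
      · simp only [F, h, false_and, if_false, finsum_zero]
    have hF' : (Function.support fun z => F (e z)).Finite :=
      (hF.preimage e.injective.injOn).subset fun z hz => hz
    rw [h1, ← finsum_comp_equiv e, finsum_curry _ hF']
    refine finsum_congr fun z => ?_
    by_cases h : toPC z.1 * toPC z.2.1 * toPC z.2.2 = toPC p
    · have h' := h
      rw [mul_assoc] at h'
      obtain ⟨n, hn⟩ := hex' _ _ _ _ h'
      rw [finsum_eq_single _ n]
      · rw [hn] at h'
        simp only [F, g, e, Equiv.coe_fn_mk, h', hn, and_self, if_true, mul_assoc]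
      · intro m hm
        simp only [F, e, Equiv.coe_fn_mk]
        exact if_neg fun hc => hm (toPC_injective (hc.2.symm.trans hn))
    · simp only [g, if_neg h]
      refine finsum_eq_zero_of_forall_eq_zero fun m => if_neg ?_
      rintro ⟨h1, h2⟩
      simp only [e, Equiv.coe_fn_mk] at h1 h2
      exact h (by rw [mul_assoc, h2, h1])
  rw [hL, hR]

noncomputable instance : Ring (BInf K) :=
  { (inferInstance : AddCommGroup (BInf K)) with
    mul := (· * ·)
    one := 1
    mul_assoc := mul_assoc'
    one_mul := one_mul'
    mul_one := mul_one'
    left_distrib := left_distrib'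
    right_distrib := right_distrib'
    zero_mul := fun s => by
      have h := right_distrib' 0 0 s
      rw [add_zero] at h
      exact left_eq_add.1 h
    mul_zero := fun s => by
      have h := left_distrib' s 0 0
      rw [add_zero] at h
      exact left_eq_add.1 h }

noncomputable instance : Algebra K (BInf K) := Algebra.ofModule smul_mul' (fun c s t => mul_smul' c s t)

/-- `s` is the formal sum `∑_{i ∈ I} fᵢ`: for each `p`, only finitely many of the `fᵢ` have a nonzero
coefficient at `p`, and the sum of these is the coefficient of `s` at `p`. -/
def IsSum {I : Type*} (f : I → BInf K) (s : BInf K) : Prop :=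
  ∀ p : Word × Word, {i | (f i).coeff p ≠ 0}.Finite ∧ s.coeff p = ∑ᶠ i, (f i).coeff p

open Classical in
/-- `∑_{q ∈ Q} q q⁻¹`. -/
noncomputable def diag (Q : Set Word) : BInf K :=
  ⟨fun p => if p.1 = p.2 ∧ p.1 ∈ Q then 1 else 0, by
    constructor
    · intro v
      refine (Set.finite_singleton v).subset fun u hu => ?_
      have h : v = u ∧ v ∈ Q := by by_contra h; exact hu (if_neg h)
      exact h.1.symm
    · intro u
      refine (Set.finite_singleton u).subset fun v hv => ?_
      have h : v = u ∧ v ∈ Q := by by_contra h; exact hv (if_neg h)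
      exact h.1⟩

theorem isSum_diag (Q : Set Word) : IsSum (fun q : Q => mono q.1 q.1) (diag Q : BInf K) := by
  classical
  intro p
  have hne : ∀ q : Q, (mono q.1 q.1 : BInf K).coeff p ≠ 0 → p = (q.1, q.1) := fun q h => by
    by_contra hp; exact h (if_neg hp)
  refine ⟨Set.Subsingleton.finite fun q hq r hr =>
    Subtype.ext (congrArg Prod.fst ((hne q hq).symm.trans (hne r hr))), ?_⟩
  by_cases h : p.1 = p.2 ∧ p.1 ∈ Q
  · rw [finsum_eq_single _ ⟨p.1, h.2⟩]
    · have hp : p = (p.1, p.1) := Prod.ext rfl h.1.symm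
      rw [coeff_mono, if_pos hp]
      exact if_pos h
    · intro q hq
      by_contra hc
      exact hq (Subtype.ext (congrArg Prod.fst (hne q hc)).symm)
  · rw [finsum_eq_zero_of_forall_eq_zero]
    · exact if_neg h
    · intro q
      by_contra hc
      have hp := hne q hc
      exact h (by rw [hp]; exact ⟨rfl, q.2⟩)

end BInf

/-! ### The algebras `𝒜_∞` and `𝒞_∞ = 𝒜_∞ / I_∞` -/

/-- The set `𝒰_∞^part` of partial unary sums `∑_{i ∈ I} yᵢ xᵢ⁻¹`: both `i ↦ xᵢ` and `i ↦ yᵢ` are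
bijections from the index set `I ⊆ ℕ` onto a prefix code. -/
def UInfPart : Set (BInf K) :=
  {s | ∃ (I : Set ℕ) (x y : I → Word), Function.Injective x ∧ Function.Injective y ∧
    IsPrefixCode (Set.range x) ∧ IsPrefixCode (Set.range y) ∧
    BInf.IsSum (fun i => BInf.mono (y i) (x i)) s}

/-- The set `𝒰_∞` of unary sums: both prefix codes are maximal. -/
def UInf : Set (BInf K) :=
  {s | ∃ (I : Set ℕ) (x y : I → Word), Function.Injective x ∧ Function.Injective y ∧
    IsMaximalPrefixCode (Set.range x) ∧ IsMaximalPrefixCode (Set.range y) ∧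
    BInf.IsSum (fun i => BInf.mono (y i) (x i)) s}

/-- `𝒜_∞`: the subalgebra of `ℬ_∞` generated by `𝒰_∞^part`. -/
noncomputable def AInf : Subalgebra K (BInf K) := Algebra.adjoin K (UInfPart K)

/-- The ideal `I_∞` of `𝒜_∞` generated by the sums `∑_{i ∈ I} yᵢ (∑_{q ∈ Qᵢ} q q⁻¹ - 1) xᵢ⁻¹`, where
`i ↦ xᵢ` and `i ↦ yᵢ` are bijections from `I ⊆ ℕ` onto a maximal prefix code, and all the `Qᵢ` are
maximal prefix codes. -/
noncomputable def IInf : TwoSidedIdeal (AInf K) :=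
  TwoSidedIdeal.span {s | ∃ (I : Set ℕ) (x y : I → Word) (Q : I → Set Word),
    Function.Injective x ∧ Function.Injective y ∧
    IsMaximalPrefixCode (Set.range x) ∧ IsMaximalPrefixCode (Set.range y) ∧
    (∀ i, IsMaximalPrefixCode (Q i)) ∧
    BInf.IsSum (fun i => BInf.mono (y i) [] * (BInf.diag (Q i) - 1) * BInf.mono [] (x i))
      (s : BInf K)}

/-- `𝒞_∞ = 𝒜_∞ / I_∞`. -/
abbrev CInf : Type _ := (IInf K).ringCon.Quotient

/-- `𝒰_∞ / I_∞`: the set of the classes of the elements of `𝒰_∞` in `𝒞_∞`. -/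
def UInfmodIInf : Set (CInf K) := (IInf K).ringCon.mk' '' {s : AInf K | (s : BInf K) ∈ UInf K}

end AlgebraB

end Thompson

/-!
A unary sum `∑ yᵢ xᵢ⁻¹` whose `xᵢ` and `yᵢ` run through maximal prefix codes is the table of an
isomorphism between essential right ideals, `xᵢ z ↦ yᵢ z`. Products of tables are tables, and they
compute compositions. Conversely, an isomorphism has a canonical table, given by the minimal words
of its domain, and every other table of a restriction of it arises from this one by replacing
`yᵢ xᵢ⁻¹` with `∑_{q ∈ Qᵢ} yᵢ q (xᵢ q)⁻¹` for some maximal prefix codes `Qᵢ`. The ideals `I_V` and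
`I_∞` identify exactly these sums, so sending `φ` to the class of its table is a homomorphism onto
`𝒰_V / I_V` or `𝒰_∞ / I_∞`.

It is injective on `𝒢_{2,1}` because every element `s` of `I_∞` satisfies `w⁻¹ s = 0` for a dense
set of words `w`, and `w⁻¹ s` is `v⁻¹` when `s` is a table that sends `v` to `w`. Injectivity on `V`
follows by means of the homomorphism `𝒞_V → 𝒞_∞` that exists since `a a⁻¹ + b b⁻¹ - 1 ∈ I_∞`.
-/

namespace Thompson

/-! ### Tables -/

theorem exists_append_eq_append_iff {u v : Word} :
    (∃ x z, u ++ x = v ++ z) ↔ u <+: v ∨ v <+: u := by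
  constructor
  · rintro ⟨x, z, h⟩
    exact List.prefix_or_prefix_of_prefix ⟨x, h⟩ ⟨z, rfl⟩
  · rintro (⟨x, rfl⟩ | ⟨z, rfl⟩)
    · exact ⟨x, [], by simp⟩
    · exact ⟨[], z, by simp⟩

theorem isMaximalPrefixCode_iff {C : Set Word} : IsMaximalPrefixCode C ↔
    IsPrefixCode C ∧ ∀ u, ∃ c ∈ C, ∃ x z, u ++ x = c ++ z := by
  simp only [exists_append_eq_append_iff]
  constructor
  · rintro ⟨hC, hmax⟩
    refine ⟨hC, fun u => ?_⟩
    by_contra! hu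
    have hinsert : IsPrefixCode (insert u C) := by
      rintro v (rfl | hv) w (rfl | hw) hvw
      · rfl
      · exact ((hu w hw).1 hvw).elim
      · exact ((hu v hv).2 hvw).elim
      · exact hC v hv w hw hvw
    have huC : u ∈ C := hmax _ hinsert (Set.subset_insert u C) ▸ Set.mem_insert u C
    exact (hu u huC).1 List.prefix_rfl
  · rintro ⟨hC, htotal⟩
    refine ⟨hC, fun D hD hle => hle.antisymm fun d hd => ?_⟩
    obtain ⟨c, hc, h | h⟩ := htotal d
    · rwa [hD d hd c (hle hc) h]
    · rwa [← hD c (hle hc) d hd h]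

/-- A set of pairs `(y, x)` that is the graph of a bijection between two prefix codes. It encodes
the element `∑ y x⁻¹` of `𝒰_∞^part`. -/
structure IsTable (S : Set (Word × Word)) : Prop where
  fst : ∀ p ∈ S, ∀ q ∈ S, p.1 <+: q.1 → p = q
  snd : ∀ p ∈ S, ∀ q ∈ S, p.2 <+: q.2 → p = q

/-- A table between two maximal prefix codes. It encodes an element of `𝒰_∞`. -/
structure IsTotalTable (S : Set (Word × Word)) : Prop extends IsTable S where
  fst_total : ∀ u, ∃ p ∈ S, ∃ x z, u ++ x = p.1 ++ z
  snd_total : ∀ u, ∃ p ∈ S, ∃ x z, u ++ x = p.2 ++ z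

theorem isTable_singleton (p : Word × Word) : IsTable {p} :=
  ⟨by rintro _ rfl _ rfl -; rfl, by rintro _ rfl _ rfl -; rfl⟩

theorem isTotalTable_one : IsTotalTable {([], [])} where
  toIsTable := isTable_singleton _
  fst_total u := ⟨_, rfl, [], u, by simp⟩
  snd_total u := ⟨_, rfl, [], u, by simp⟩

section

variable {I : Type*} {x y : I → Word}

theorem isTable_range (hx : Function.Injective x) (hy : Function.Injective y)
    (hX : IsPrefixCode (Set.range x)) (hY : IsPrefixCode (Set.range y)) :
    IsTable (Set.range fun i => (y i, x i)) where
  fst := by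
    rintro _ ⟨i, rfl⟩ _ ⟨j, rfl⟩ h
    rw [hy (hY _ ⟨i, rfl⟩ _ ⟨j, rfl⟩ h)]
  snd := by
    rintro _ ⟨i, rfl⟩ _ ⟨j, rfl⟩ h
    rw [hx (hX _ ⟨i, rfl⟩ _ ⟨j, rfl⟩ h)]

theorem isTotalTable_range (hx : Function.Injective x) (hy : Function.Injective y)
    (hX : IsMaximalPrefixCode (Set.range x)) (hY : IsMaximalPrefixCode (Set.range y)) :
    IsTotalTable (Set.range fun i => (y i, x i)) where
  toIsTable := isTable_range hx hy hX.1 hY.1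
  fst_total u := by simpa using (isMaximalPrefixCode_iff.1 hY).2 u
  snd_total u := by simpa using (isMaximalPrefixCode_iff.1 hX).2 u

end

section

variable {S T : Set (Word × Word)}

theorem IsTable.injOn_fst (hS : IsTable S) : Set.InjOn Prod.fst S :=
  fun p hp q hq h => hS.fst p hp q hq (by rw [h])

theorem IsTable.injOn_snd (hS : IsTable S) : Set.InjOn Prod.snd S :=
  fun p hp q hq h => hS.snd p hp q hq (by rw [h])

theorem IsTable.isPrefixCode_fst (hS : IsTable S) : IsPrefixCode (Prod.fst '' S) := by
  rintro _ ⟨p, hp, rfl⟩ _ ⟨q, hq, rfl⟩ h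
  rw [hS.fst p hp q hq h]

theorem IsTable.isPrefixCode_snd (hS : IsTable S) : IsPrefixCode (Prod.snd '' S) := by
  rintro _ ⟨p, hp, rfl⟩ _ ⟨q, hq, rfl⟩ h
  rw [hS.snd p hp q hq h]

theorem IsTotalTable.isMaximalPrefixCode_fst (hS : IsTotalTable S) :
    IsMaximalPrefixCode (Prod.fst '' S) :=
  isMaximalPrefixCode_iff.2
    ⟨hS.isPrefixCode_fst, fun u => Set.exists_mem_image.2 (hS.fst_total u)⟩

theorem IsTotalTable.isMaximalPrefixCode_snd (hS : IsTotalTable S) :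
    IsMaximalPrefixCode (Prod.snd '' S) :=
  isMaximalPrefixCode_iff.2
    ⟨hS.isPrefixCode_snd, fun u => Set.exists_mem_image.2 (hS.snd_total u)⟩

theorem IsTable.finiteToFinite (hS : IsTable S) : FiniteToFinite S :=
  ⟨fun _ => Set.Subsingleton.finite fun _ hx _ hx' => congrArg Prod.snd (hS.injOn_fst hx hx' rfl),
    fun _ => Set.Subsingleton.finite fun _ hy _ hy' =>
      congrArg Prod.fst (hS.injOn_snd hy hy' rfl)⟩

theorem IsTable.swap (hS : IsTable S) : IsTable (Prod.swap ⁻¹' S) where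
  fst _ hp _ hq h := Prod.swap_injective (hS.snd _ hp _ hq h)
  snd _ hp _ hq h := Prod.swap_injective (hS.fst _ hp _ hq h)

theorem IsTotalTable.swap (hS : IsTotalTable S) : IsTotalTable (Prod.swap ⁻¹' S) where
  toIsTable := hS.toIsTable.swap
  fst_total u := let ⟨p, hp, h⟩ := hS.snd_total u; ⟨p.swap, by simpa using hp, h⟩
  snd_total u := let ⟨p, hp, h⟩ := hS.fst_total u; ⟨p.swap, by simpa using hp, h⟩

end

/-! ### The action of a table on words -/

theorem graph_toPC_self (p : Word × Word) : PC.Graph (toPC p) p.2 p.1 := ⟨[], by simp, by simp⟩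

theorem graph_toPC_swap {p : Word × Word} {w c : Word} :
    PC.Graph (toPC p.swap) w c ↔ PC.Graph (toPC p) c w :=
  ⟨fun ⟨z, h, h'⟩ => ⟨z, h', h⟩, fun ⟨z, h, h'⟩ => ⟨z, h', h⟩⟩

theorem graph_functional {p : PC} {w c c' : Word} (h : PC.Graph p w c) (h' : PC.Graph p w c') :
    c = c' := by
  cases p with
  | zero => exact h.elim
  | pair y x =>
    obtain ⟨z, rfl, rfl⟩ := h
    obtain ⟨z', h, rfl⟩ := h'
    rw [List.append_cancel_left h]

theorem graph_append {p : PC} {w c : Word} (h : PC.Graph p w c) (x : Word) :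
    PC.Graph p (w ++ x) (c ++ x) := by
  cases p with
  | zero => exact h.elim
  | pair y x' =>
    obtain ⟨z, rfl, rfl⟩ := h
    exact ⟨z ++ x, by simp, by simp⟩

/-- The partial map on words with table `S`: it sends `x z` to `y z` for all `(y, x) ∈ S`. -/
def Sends (S : Set (Word × Word)) (w c : Word) : Prop :=
  ∃ p ∈ S, PC.Graph (toPC p) w c

/-- `S` refines `T`: every pair of `S` is `(y z, x z)` for some `(y, x) ∈ T`. -/
def Refines (S T : Set (Word × Word)) : Prop :=
  ∀ p ∈ S, Sends T p.2 p.1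

section

variable {S T : Set (Word × Word)} {w w' c c' : Word}

theorem sends_of_mem {p : Word × Word} (hp : p ∈ S) : Sends S p.2 p.1 :=
  ⟨p, hp, graph_toPC_self p⟩

theorem sends_swap : Sends (Prod.swap ⁻¹' S) w c ↔ Sends S c w :=
  ⟨fun ⟨p, hp, h⟩ => ⟨p.swap, hp, graph_toPC_swap.2 h⟩,
    fun ⟨p, hp, h⟩ => ⟨p.swap, by simpa using hp, graph_toPC_swap.2 h⟩⟩

theorem Sends.append (h : Sends S w c) (x : Word) : Sends S (w ++ x) (c ++ x) := by
  obtain ⟨p, hp, h⟩ := h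
  exact ⟨p, hp, graph_append h x⟩

theorem Refines.sends (hST : Refines S T) (h : Sends S w c) : Sends T w c := by
  obtain ⟨p, hp, z, rfl, rfl⟩ := h
  exact (hST p hp).append z

theorem IsTotalTable.exists_sends_source (hS : IsTotalTable S) (u : Word) :
    ∃ x c, Sends S (u ++ x) c := by
  obtain ⟨p, hp, x, z, h⟩ := hS.snd_total u
  exact ⟨x, p.1 ++ z, p, hp, z, h, rfl⟩

theorem IsTotalTable.exists_sends_target (hS : IsTotalTable S) (u : Word) :
    ∃ x w, Sends S w (u ++ x) := by
  simpa only [sends_swap] using hS.swap.exists_sends_source u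

theorem IsTable.eq_of_graph_source (hS : IsTable S) {p q : Word × Word} (hp : p ∈ S) (hq : q ∈ S)
    (h : PC.Graph (toPC p) w c) (h' : PC.Graph (toPC q) w c') : p = q := by
  obtain ⟨z, rfl, -⟩ := h
  obtain ⟨z', h', -⟩ := h'
  rcases List.prefix_or_prefix_of_prefix ⟨z, rfl⟩ ⟨z', h'.symm⟩ with h | h
  · exact hS.snd p hp q hq h
  · exact (hS.snd q hq p hp h).symm

theorem IsTable.eq_of_graph_target (hS : IsTable S) {p q : Word × Word} (hp : p ∈ S) (hq : q ∈ S)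
    (h : PC.Graph (toPC p) w c) (h' : PC.Graph (toPC q) w' c) : p = q :=
  Prod.swap_injective <| hS.swap.eq_of_graph_source (by simpa using hp) (by simpa using hq)
    (graph_toPC_swap.2 h) (graph_toPC_swap.2 h')

theorem IsTable.sends_functional (hS : IsTable S) (h : Sends S w c) (h' : Sends S w c') :
    c = c' := by
  obtain ⟨p, hp, h⟩ := h
  obtain ⟨q, hq, h'⟩ := h'
  obtain rfl := hS.eq_of_graph_source hp hq h h'
  exact graph_functional h h'

theorem IsTable.sends_injective (hS : IsTable S) (h : Sends S w c) (h' : Sends S w' c) :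
    w = w' :=
  hS.swap.sends_functional (sends_swap.2 h) (sends_swap.2 h')

/-! ### Products of tables -/

theorem sends_mulRel : Sends (mulRel S T) w c ↔ ∃ m, Sends T w m ∧ Sends S m c := by
  constructor
  · rintro ⟨p, ⟨q, hq, r, hr, h⟩, hp⟩
    rw [← h, PC.graph_mul] at hp
    obtain ⟨m, hm, hm'⟩ := hp
    exact ⟨m, ⟨r, hr, hm⟩, q, hq, hm'⟩
  · rintro ⟨m, ⟨r, hr, hm⟩, q, hq, hm'⟩
    have hgraph : PC.Graph (toPC q * toPC r) w c := (PC.graph_mul ..).2 ⟨m, hm, hm'⟩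
    rcases hqr : toPC q * toPC r with _ | ⟨y, x⟩
    · rw [hqr] at hgraph
      exact hgraph.elim
    · exact ⟨(y, x), ⟨q, hq, r, hr, hqr⟩, show PC.Graph (PC.pair y x) w c from hqr ▸ hgraph⟩

theorem swap_preimage_mulRel :
    Prod.swap ⁻¹' mulRel S T = mulRel (Prod.swap ⁻¹' T) (Prod.swap ⁻¹' S) := by
  ext p
  constructor
  · rintro ⟨q, hq, r, hr, h⟩
    exact ⟨r.swap, by simpa using hr, q.swap, by simpa using hq, by simpa using toPC_swap_mul h⟩
  · rintro ⟨r, hr, q, hq, h⟩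
    exact ⟨q.swap, hq, r.swap, hr, toPC_swap_mul h⟩

theorem IsTable.eq_of_graph_mul (hS : IsTable S) (hT : IsTable T) {q q' r r' : Word × Word}
    (hq : q ∈ S) (hr : r ∈ T) (h : PC.Graph (toPC q * toPC r) w c)
    (hq' : q' ∈ S) (hr' : r' ∈ T) (h' : PC.Graph (toPC q' * toPC r') w c') :
    q = q' ∧ r = r' := by
  obtain ⟨m, hm, hc⟩ := (PC.graph_mul ..).1 h
  obtain ⟨m', hm', hc'⟩ := (PC.graph_mul ..).1 h'
  obtain rfl := hT.eq_of_graph_source hr hr' hm hm'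
  obtain rfl := graph_functional hm hm'
  exact ⟨hS.eq_of_graph_source hq hq' hc hc', rfl⟩

theorem IsTable.factorization_unique (hS : IsTable S) (hT : IsTable T) {p q q' r r' : Word × Word}
    (hq : q ∈ S) (hr : r ∈ T) (h : toPC q * toPC r = toPC p)
    (hq' : q' ∈ S) (hr' : r' ∈ T) (h' : toPC q' * toPC r' = toPC p) : q = q' ∧ r = r' :=
  hS.eq_of_graph_mul hT hq hr (h ▸ graph_toPC_self p) hq' hr' (h' ▸ graph_toPC_self p)

theorem IsTable.mulRel_snd (hS : IsTable S) (hT : IsTable T) {p p' : Word × Word}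
    (hp : p ∈ mulRel S T) (hp' : p' ∈ mulRel S T) (h : p.2 <+: p'.2) : p = p' := by
  obtain ⟨q, hq, r, hr, hqr⟩ := hp
  obtain ⟨q', hq', r', hr', hqr'⟩ := hp'
  obtain ⟨z, hz⟩ := h
  have hgraph : PC.Graph (toPC q * toPC r) p'.2 (p.1 ++ z) := hqr ▸ ⟨z, hz.symm, rfl⟩
  obtain ⟨rfl, rfl⟩ := hS.eq_of_graph_mul hT hq hr hgraph hq' hr' (hqr' ▸ graph_toPC_self p')
  exact toPC_injective (hqr.symm.trans hqr')

theorem IsTable.mulRel (hS : IsTable S) (hT : IsTable T) : IsTable (mulRel S T) where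
  fst p hp p' hp' h := Prod.swap_injective <| hT.swap.mulRel_snd hS.swap
    (by rw [← swap_preimage_mulRel]; simpa using hp)
    (by rw [← swap_preimage_mulRel]; simpa using hp') h
  snd _ hp _ hp' h := hS.mulRel_snd hT hp hp' h

theorem IsTotalTable.mulRel_snd_total (hS : IsTotalTable S) (hT : IsTotalTable T) (u : Word) :
    ∃ p ∈ Thompson.mulRel S T, ∃ x z, u ++ x = p.2 ++ z := by
  obtain ⟨x, m, hm⟩ := hT.exists_sends_source u
  obtain ⟨x', c, hc⟩ := hS.exists_sends_source m
  obtain ⟨p, hp, z, hz, -⟩ := sends_mulRel.2 ⟨_, hm.append x', hc⟩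
  exact ⟨p, hp, x ++ x', z, by simpa using hz⟩

theorem IsTotalTable.mulRel (hS : IsTotalTable S) (hT : IsTotalTable T) :
    IsTotalTable (mulRel S T) where
  toIsTable := hS.toIsTable.mulRel hT.toIsTable
  fst_total u := by
    obtain ⟨p, hp, h⟩ := hT.swap.mulRel_snd_total hS.swap u
    rw [← swap_preimage_mulRel] at hp
    exact ⟨p.swap, hp, h⟩
  snd_total := hS.mulRel_snd_total hT

end

/-! ### Refinements of tables -/

/-- The refinement `{(y q, x q) | q ∈ Q}` of the one-pair table `{(y, x)}`, where `t = (y, x)`. -/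
def extend (t : Word × Word) (Q : Set Word) : Set (Word × Word) :=
  (fun q => (t.1 ++ q, t.2 ++ q)) '' Q

/-- The words `q` such that `(y q, x q) ∈ S`, where `t = (y, x)`. -/
def extensions (S : Set (Word × Word)) (t : Word × Word) : Set Word :=
  {q | (t.1 ++ q, t.2 ++ q) ∈ S}

theorem isTable_extend (t : Word × Word) {Q : Set Word} (hQ : IsPrefixCode Q) :
    IsTable (extend t Q) where
  fst := by
    rintro _ ⟨q, hq, rfl⟩ _ ⟨q', hq', rfl⟩ h
    rw [hQ q hq q' hq' ((List.prefix_append_right_inj _).1 h)]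
  snd := by
    rintro _ ⟨q, hq, rfl⟩ _ ⟨q', hq', rfl⟩ h
    rw [hQ q hq q' hq' ((List.prefix_append_right_inj _).1 h)]

theorem graph_of_mem_extend {t p : Word × Word} {Q : Set Word} (hp : p ∈ extend t Q) :
    PC.Graph (toPC t) p.2 p.1 := by
  obtain ⟨q, -, rfl⟩ := hp
  exact ⟨q, rfl, rfl⟩

section

variable {I : Type*} {f : I → Word × Word} {Q : I → Set Word}

theorem refines_iUnion_extend (f : I → Word × Word) (Q : I → Set Word) :
    Refines (⋃ i, extend (f i) (Q i)) (Set.range f) := by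
  intro p hp
  obtain ⟨i, hi⟩ := Set.mem_iUnion.1 hp
  exact ⟨f i, ⟨i, rfl⟩, graph_of_mem_extend hi⟩

theorem pairwise_disjoint_extend (hf : Function.Injective f) (hT : IsTable (Set.range f))
    (Q : I → Set Word) : Pairwise (Function.onFun Disjoint fun i => extend (f i) (Q i)) :=
  fun i j hij => Set.disjoint_left.2 fun _ hp hp' => hij <| hf <|
    hT.eq_of_graph_source ⟨i, rfl⟩ ⟨j, rfl⟩ (graph_of_mem_extend hp) (graph_of_mem_extend hp')

theorem isTotalTable_iUnion_extend (hf : Function.Injective f) (hT : IsTotalTable (Set.range f))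
    (hQ : ∀ i, IsMaximalPrefixCode (Q i)) : IsTotalTable (⋃ i, extend (f i) (Q i)) where
  fst p hp p' hp' h := by
    obtain ⟨i, hi⟩ := Set.mem_iUnion.1 hp
    obtain ⟨j, hj⟩ := Set.mem_iUnion.1 hp'
    obtain ⟨z, hz⟩ := h
    obtain rfl : i = j := hf <| hT.eq_of_graph_target ⟨i, rfl⟩ ⟨j, rfl⟩
      (graph_append (graph_of_mem_extend hi) z) (hz ▸ graph_of_mem_extend hj)
    exact (isTable_extend (f i) (hQ i).1).fst p hi p' hj ⟨z, hz⟩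
  snd p hp p' hp' h := by
    obtain ⟨i, hi⟩ := Set.mem_iUnion.1 hp
    obtain ⟨j, hj⟩ := Set.mem_iUnion.1 hp'
    obtain ⟨z, hz⟩ := h
    obtain rfl : i = j := hf <| hT.eq_of_graph_source ⟨i, rfl⟩ ⟨j, rfl⟩
      (graph_append (graph_of_mem_extend hi) z) (hz ▸ graph_of_mem_extend hj)
    exact (isTable_extend (f i) (hQ i).1).snd p hi p' hj ⟨z, hz⟩
  fst_total u := by
    obtain ⟨_, ⟨i, rfl⟩, x, z, h⟩ := hT.fst_total u
    obtain ⟨q, hq, x', z', h'⟩ := (isMaximalPrefixCode_iff.1 (hQ i)).2 z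
    exact ⟨_, Set.mem_iUnion.2 ⟨i, q, hq, rfl⟩, x ++ x', z', by
      rw [← List.append_assoc, h, List.append_assoc, h', List.append_assoc]⟩
  snd_total u := by
    obtain ⟨_, ⟨i, rfl⟩, x, z, h⟩ := hT.snd_total u
    obtain ⟨q, hq, x', z', h'⟩ := (isMaximalPrefixCode_iff.1 (hQ i)).2 z
    exact ⟨_, Set.mem_iUnion.2 ⟨i, q, hq, rfl⟩, x ++ x', z', by
      rw [← List.append_assoc, h, List.append_assoc, h', List.append_assoc]⟩

end

section

variable {S T : Set (Word × Word)}

theorem Refines.iUnion_extend {I : Type*} {f : I → Word × Word} (h : Refines S (Set.range f)) :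
    ⋃ i, extend (f i) (extensions S (f i)) = S := by
  ext p
  simp only [Set.mem_iUnion]
  constructor
  · rintro ⟨i, q, hq, rfl⟩
    exact hq
  · intro hp
    obtain ⟨_, ⟨i, rfl⟩, z, hz, hz'⟩ := h p hp
    obtain rfl : p = ((f i).1 ++ z, (f i).2 ++ z) := Prod.ext hz' hz
    exact ⟨i, z, hp, rfl⟩

theorem IsTotalTable.isMaximalPrefixCode_extensions (hS : IsTotalTable S) (hT : IsTable T)
    (h : Refines S T) {t : Word × Word} (ht : t ∈ T) :
    IsMaximalPrefixCode (extensions S t) := by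
  refine isMaximalPrefixCode_iff.2 ⟨fun q hq q' hq' hle => ?_, fun u => ?_⟩
  · have := hS.fst _ hq _ hq' ((List.prefix_append_right_inj t.1).2 hle)
    exact List.append_cancel_left (congrArg Prod.fst this)
  · obtain ⟨p, hp, x, z, hxz⟩ := hS.snd_total (t.2 ++ u)
    obtain ⟨t', ht', hgraph⟩ := h p hp
    obtain rfl := hT.eq_of_graph_source ht' ht (graph_append hgraph z)
      (hxz ▸ ⟨u ++ x, by simp, rfl⟩ : PC.Graph (toPC t) (p.2 ++ z) (t.1 ++ (u ++ x)))
    obtain ⟨q, hq, hq'⟩ := hgraph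
    refine ⟨q, by rwa [extensions, Set.mem_ofPred_eq, ← hq, ← hq'], x, z, ?_⟩
    rw [hq, List.append_assoc, List.append_assoc] at hxz
    exact List.append_cancel_left hxz

end

/-! ### Tables of right-ideal isomorphisms -/

theorem mem_dite_choose_iff {γ : Type*} {P : γ → Prop} [Decidable (∃ c, P c)]
    (hP : ∀ c c', P c → P c' → c = c') (c : γ) :
    c ∈ (if h : ∃ c, P c then some h.choose else none) ↔ P c := by
  by_cases h : ∃ c, P c
  · rw [dif_pos h, Option.mem_some_iff]
    exact ⟨fun e => e ▸ h.choose_spec, hP _ _ h.choose_spec⟩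
  · rw [dif_neg h]
    exact ⟨fun e => (Option.not_mem_none _ e).elim, fun e => (h ⟨c, e⟩).elim⟩

theorem exists_pequiv_of_biUnique {α β : Type*} {R : α → β → Prop} (hR : Relator.BiUnique R) :
    ∃ φ : α ≃. β, ∀ a b, b ∈ φ a ↔ R a b := by
  classical
  have mem_left (a : α) := mem_dite_choose_iff (P := R a) fun _ _ h h' => hR.2 h h'
  have mem_right (b : β) := mem_dite_choose_iff (P := (R · b)) fun _ _ h h' => hR.1 h h'
  exact ⟨⟨fun a => if h : ∃ b, R a b then some h.choose else none,
    fun b => if h : ∃ a, R a b then some h.choose else none,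
    fun a b => (mem_right b a).trans (mem_left a b).symm⟩, mem_left⟩

/-- The table of `φ`: the pairs `(φ x, x)` where `x` ranges over the prefix code that generates the
domain of `φ`. -/
def table (φ : Word ≃. Word) : Set (Word × Word) :=
  {p | p.1 ∈ φ p.2 ∧ ∀ q ∈ dom φ, q <+: p.2 → q = p.2}

section

variable {φ : Word ≃. Word}

theorem sends_table_iff (hφ : IsRightIdealIso φ) {w c : Word} :
    Sends (table φ) w c ↔ c ∈ φ w := by
  constructor
  · rintro ⟨p, hp, z, rfl, rfl⟩
    exact hφ.map_append _ _ hp.1 z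
  intro hc
  induction hl : w.length using Nat.strong_induction_on generalizing w c with
  | _ l ih =>
    by_cases hmin : ∀ q ∈ dom φ, q <+: w → q = w
    · exact sends_of_mem (p := (c, w)) ⟨hc, hmin⟩
    · push Not at hmin
      obtain ⟨q, ⟨d, hd⟩, ⟨z, rfl⟩, hne⟩ := hmin
      have hz : 0 < z.length := List.length_pos_iff.2 fun hz => hne (by simp [hz])
      have hq : q.length < l := by rw [← hl, List.length_append]; omega
      obtain rfl := Option.mem_unique hc (hφ.map_append _ _ hd z)
      exact (ih q.length hq hd rfl).append z

theorem isTable_table (hφ : IsRightIdealIso φ) : IsTable (table φ) where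
  fst := by
    rintro ⟨_, x⟩ ⟨hp, -⟩ ⟨_, x'⟩ ⟨hq, hmin⟩ ⟨z, rfl⟩
    obtain rfl : x' = x ++ z := φ.inj hq (hφ.map_append _ _ hp z)
    obtain rfl : z = [] := by simpa using hmin x ⟨_, hp⟩ ⟨z, rfl⟩
    simp
  snd := by
    rintro ⟨y, x⟩ ⟨hp, -⟩ ⟨y', x'⟩ ⟨hq, hmin⟩ h
    obtain rfl : x = x' := hmin x ⟨_, hp⟩ h
    exact congrArg (·, x) (Option.mem_unique hp hq)

theorem isTotalTable_table (hφ : IsEssentialIso φ) : IsTotalTable (table φ) where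
  toIsTable := isTable_table hφ.toIsRightIdealIso
  fst_total u := by
    obtain ⟨x, w, hw⟩ := hφ.ran_essential.exists_append u
    obtain ⟨p, hp, z, -, h⟩ := (sends_table_iff hφ.toIsRightIdealIso).2 hw
    exact ⟨p, hp, x, z, h⟩
  snd_total u := by
    obtain ⟨x, c, hc⟩ := hφ.dom_essential.exists_append u
    obtain ⟨p, hp, z, h, -⟩ := (sends_table_iff hφ.toIsRightIdealIso).2 hc
    exact ⟨p, hp, x, z, h⟩

theorem IsTotalTable.exists_iso {S : Set (Word × Word)} (hS : IsTotalTable S) :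
    ∃ φ : Word ≃. Word, IsEssentialIso φ ∧ ∀ w c, c ∈ φ w ↔ Sends S w c := by
  obtain ⟨φ, hφ⟩ := exists_pequiv_of_biUnique (R := Sends S)
    ⟨fun _ _ _ => hS.sends_injective, fun _ _ _ => hS.sends_functional⟩
  have hiso : IsRightIdealIso φ := isRightIdealIso_of_map_append fun w c h x =>
    (hφ _ _).2 (((hφ w c).1 h).append x)
  refine ⟨φ, ⟨hiso, isEssential_of_exists hiso.dom_ideal fun u => ?_,
    isEssential_of_exists hiso.ran_ideal fun u => ?_⟩, hφ⟩
  · obtain ⟨x, c, h⟩ := hS.exists_sends_source u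
    exact ⟨x, c, (hφ _ _).2 h⟩
  · obtain ⟨x, w, h⟩ := hS.exists_sends_target u
    exact ⟨x, w, (hφ _ _).2 h⟩

end

namespace G21

theorem isTotalTable_table (φ : G21) : IsTotalTable (table φ.1) :=
  Thompson.isTotalTable_table φ.2.toIsEssentialIso

theorem sends_table_iff (φ : G21) {w c : Word} : Sends (table φ.1) w c ↔ c ∈ φ.1 w :=
  Thompson.sends_table_iff φ.2.toIsRightIdealIso

theorem table_one : table (1 : G21).1 = {([], [])} := by
  ext ⟨y, x⟩
  constructor
  · rintro ⟨h, hmin⟩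
    obtain rfl : x = y := by simpa using Option.mem_some_iff.1 h
    obtain rfl : [] = x := hmin [] ⟨[], rfl⟩ List.nil_prefix
    rfl
  · rintro ⟨rfl, rfl⟩
    exact ⟨rfl, fun q _ hq => List.prefix_nil.1 hq⟩

theorem refines_mulRel_table (φ ψ : G21) :
    Refines (mulRel (table φ.1) (table ψ.1)) (table (φ * ψ).1) := by
  intro p hp
  obtain ⟨m, hm, hm'⟩ := sends_mulRel.1 (sends_of_mem hp)
  exact (φ * ψ).sends_table_iff.2 <| comp_le_mul φ ψ _ _ <| (PEquiv.mem_trans _ _ _ _).2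
    ⟨m, ψ.sends_table_iff.1 hm, φ.sends_table_iff.1 hm'⟩

theorem exists_refines_table {S : Set (Word × Word)} (hS : IsTotalTable S) :
    ∃ φ : G21, Refines S (table φ.1) := by
  obtain ⟨χ, hχ, hmem⟩ := hS.exists_iso
  refine ⟨⟨maxExt χ hχ, maxExt_maximal hχ⟩, fun p hp => ?_⟩
  exact (sends_table_iff _).2 (le_maxExt hχ _ _ ((hmem _ _).2 (sends_of_mem hp)))

/-- The common restriction used here is `ψ ∘ ψ⁻¹ ∘ φ`. -/
theorem eq_of_dense {φ ψ : G21}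
    (h : ∀ u : Word, ∃ x v, u ++ x ∈ φ.1 v ∧ u ++ x ∈ ψ.1 v) : φ = ψ := by
  refine eq_of_le ((φ.2.toIsEssentialIso.trans ψ.2.symm.toIsEssentialIso).trans
    ψ.2.toIsEssentialIso) ?_ ?_
  all_goals
    intro w c hc
    obtain ⟨n, hn, hc⟩ := (PEquiv.mem_trans _ _ _ _).1 hc
    obtain ⟨m, hm, hn⟩ := (PEquiv.mem_trans _ _ _ _).1 hn
    rw [PEquiv.mem_iff_mem] at hn
    obtain rfl := Option.mem_unique hn hc
  · exact hm
  · obtain ⟨x, v, hφ, hψ⟩ := h m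
    have hw := φ.1.inj hφ (φ.2.map_append _ _ hm x)
    have hn' := ψ.1.inj hψ (ψ.2.map_append _ _ hn x)
    rwa [eq_of_append_eq (hw.symm.trans hn')]

end G21

/-! ### Finite tables -/

theorem IsMaximalPrefixCode.isEssential_generatedBy {P : Set Word} (hP : IsMaximalPrefixCode P) :
    IsEssential (generatedBy P) := by
  refine isEssential_of_exists ?_ fun u => ?_
  · rintro _ ⟨p, hp, x, rfl⟩ z
    exact ⟨p, hp, x ++ z, by simp⟩
  · obtain ⟨p, hp, x, z, h⟩ := (isMaximalPrefixCode_iff.1 hP).2 u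
    exact ⟨x, p, hp, z, h⟩

theorem isFinGen_of_subset {R P : Set Word} (hR : IsEssential R) (hP : IsMaximalPrefixCode P)
    (hfin : P.Finite) (hPR : P ⊆ R) : IsFinGen R := by
  refine isFinGen_mono hP.isEssential_generatedBy hR ?_ ⟨P, hP.1, hfin, rfl⟩
  rintro _ ⟨p, hp, x, rfl⟩
  exact hR.1 p (hPR hp) x

theorem finite_table {φ : Word ≃. Word} (hφ : IsRightIdealIso φ) (hfin : IsFinGen (dom φ)) :
    (table φ).Finite := by
  obtain ⟨P, -, hP, hdom⟩ := hfin
  refine Set.Finite.of_finite_image (hP.subset ?_) (isTable_table hφ).injOn_snd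
  rintro _ ⟨p, ⟨hp, hmin⟩, rfl⟩
  obtain ⟨q, hq, x, hx⟩ : p.2 ∈ generatedBy P := hdom ▸ ⟨p.1, hp⟩
  have hqdom : q ∈ dom φ := hdom ▸ ⟨q, hq, [], by simp⟩
  rwa [← hmin q hqdom ⟨x, hx.symm⟩]

theorem V.finite_table (φ : V) : (table φ.1.1).Finite :=
  Thompson.finite_table φ.1.2.toIsRightIdealIso φ.2.1

theorem mem_V_of_finite_refines {S : Set (Word × Word)} (hS : IsTotalTable S) (hfin : S.Finite)
    {φ : G21} (h : Refines S (table φ.1)) : φ ∈ V := by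
  constructor
  · refine isFinGen_of_subset φ.2.dom_essential hS.isMaximalPrefixCode_snd (hfin.image _) ?_
    rintro _ ⟨p, hp, rfl⟩
    exact ⟨p.1, φ.sends_table_iff.1 (h p hp)⟩
  · refine isFinGen_of_subset φ.2.ran_essential hS.isMaximalPrefixCode_fst (hfin.image _) ?_
    rintro _ ⟨p, hp, rfl⟩
    exact ⟨p.2, φ.sends_table_iff.1 (h p hp)⟩

/-! ### Products with one-pair tables -/

section

variable {S : Set (Word × Word)} {p q m : Word × Word} {v w : Word}

theorem mulRel_singleton (h : toPC p * toPC q = toPC m) : mulRel {p} {q} = {m} := by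
  ext n
  simp [mulRel, h, toPC_injective.eq_iff, eq_comm]

theorem mulRel_singleton_eq_empty (h : toPC p * toPC q = 0) : mulRel {p} {q} = ∅ := by
  ext n
  simp only [mulRel, Set.mem_singleton_iff, exists_eq_left, Set.mem_ofPred_eq, h,
    Set.mem_empty_iff_false, iff_false]
  exact (PC.pair_ne_zero n.1 n.2).symm

theorem toPC_word_mul (y : Word) (p : Word × Word) :
    toPC (y, []) * toPC p = toPC (y ++ p.1, p.2) := by
  simp [toPC, PC.pair_mul_pair]

theorem mulRel_word_singleton (y : Word) (S : Set (Word × Word)) :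
    mulRel {(y, [])} S = (fun p => (y ++ p.1, p.2)) '' S := by
  ext n
  simp [mulRel, toPC_word_mul, toPC_injective.eq_iff, -Prod.exists]

theorem mulRel_wordInv_singleton (S : Set (Word × Word)) (x : Word) :
    mulRel S {([], x)} = (fun p => (p.1, x ++ p.2)) '' S := by
  have toPC_mul (p : Word × Word) : toPC p * toPC ([], x) = toPC (p.1, x ++ p.2) := by
    simpa using toPC_swap_mul (toPC_word_mul x p.swap)
  ext n
  simp [mulRel, toPC_mul, toPC_injective.eq_iff, -Prod.exists]

theorem mulRel_mulRel_extend (t : Word × Word) (Q : Set Word) :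
    mulRel (mulRel {(t.1, [])} (extend ([], []) Q)) {([], t.2)} = extend t Q := by
  simp only [mulRel_word_singleton, mulRel_wordInv_singleton, extend, Set.image_image,
    List.nil_append]

theorem wordInv_mul_toPC (h : PC.Graph (toPC p) v w) : PC.wordInv w * toPC p = PC.wordInv v := by
  obtain ⟨z, rfl, rfl⟩ := h
  have : toPC p.swap * toPC (p.1 ++ z, []) = toPC (p.2 ++ z, []) := by
    simp [toPC, PC.pair_mul_pair]
  exact toPC_swap_mul this

theorem IsTable.wordInv_mul_toPC_eq_zero (hS : IsTable S) (hp : p ∈ S)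
    (h : PC.Graph (toPC p) v w) (hq : q ∈ S) (hne : q ≠ p) : PC.wordInv w * toPC q = 0 := by
  rcases hm : PC.wordInv w * toPC q with _ | ⟨y, x⟩
  · rfl
  · have hgraph : PC.Graph (PC.wordInv w * toPC q) x y := hm ▸ graph_toPC_self (y, x)
    obtain ⟨_, hq', z, rfl, -⟩ := (PC.graph_mul ..).1 hgraph
    exact (hne (hS.eq_of_graph_target hq hp hq' (graph_append h z))).elim

theorem IsTable.mulRel_wordInv (hS : IsTable S) (h : Sends S v w) :
    Thompson.mulRel {([], w)} S = {([], v)} := by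
  obtain ⟨p, hp, hgraph⟩ := h
  ext m
  constructor
  · rintro ⟨_, rfl, q, hq, hm⟩
    have hqp : q = p := by_contra fun hne => PC.pair_ne_zero m.1 m.2 <|
      hm.symm.trans (hS.wordInv_mul_toPC_eq_zero hp hgraph hq hne)
    exact toPC_injective (hm.symm.trans (hqp ▸ wordInv_mul_toPC hgraph))
  · rintro rfl
    exact ⟨_, rfl, p, hp, wordInv_mul_toPC hgraph⟩

theorem mulRel_wordInv_eq_empty (h : ∀ p ∈ S, ¬∃ x z, w ++ x = p.1 ++ z) :
    mulRel {([], w)} S = ∅ := by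
  refine Set.eq_empty_of_forall_notMem ?_
  rintro m ⟨_, rfl, q, hq, hm⟩
  obtain ⟨_, ⟨z, -, hz⟩, x, hx, -⟩ := (PC.graph_mul ..).1 (hm ▸ graph_toPC_self m)
  exact h q hq ⟨x, z, hx.symm.trans hz⟩

end

namespace BInf

variable {K : Type*} [Field K]

/-! ### Formal sums in `ℬ_∞` -/

variable (K) in
open Classical in
/-- The formal sum `∑ y x⁻¹` over the pairs `(y, x) ∈ S`. -/
noncomputable def formalSum (S : Set (Word × Word)) (hS : FiniteToFinite S) : BInf K :=
  ⟨fun p => if p ∈ S then 1 else 0, hS.mono fun _ hp => by_contra fun h => hp (if_neg h)⟩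

open Classical in
theorem coeff_formalSum {S : Set (Word × Word)} (hS : FiniteToFinite S) (p : Word × Word) :
    (formalSum K S hS).coeff p = if p ∈ S then 1 else 0 := rfl

theorem formalSum_congr {S T : Set (Word × Word)} {hS : FiniteToFinite S} (h : S = T) :
    formalSum K S hS = formalSum K T (h ▸ hS) := by
  subst h
  rfl

theorem formalSum_empty (h : FiniteToFinite ∅) : formalSum K ∅ h = 0 := by
  classical
  ext p
  rw [coeff_formalSum, if_neg (Set.notMem_empty p), coeff_zero]

theorem formalSum_singleton (p : Word × Word) :
    formalSum K {p} (isTable_singleton p).finiteToFinite = mono p.1 p.2 := by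
  classical
  ext q
  simp only [coeff_formalSum, coeff_mono, Set.mem_singleton_iff, Prod.mk.eta]

theorem formalSum_extend_nil {Q : Set Word} (h : FiniteToFinite (extend ([], []) Q)) :
    formalSum K (extend ([], []) Q) h = diag Q := by
  classical
  ext p
  refine if_congr ⟨?_, ?_⟩ rfl rfl
  · rintro ⟨q, hq, rfl⟩
    exact ⟨rfl, hq⟩
  · rintro ⟨h, hp⟩
    exact ⟨p.1, hp, Prod.ext rfl h⟩

theorem formalSum_mul {S T : Set (Word × Word)} (hS : IsTable S) (hT : IsTable T) :
    formalSum K S hS.finiteToFinite * formalSum K T hT.finiteToFinite =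
      formalSum K (mulRel S T) (hS.mulRel hT).finiteToFinite := by
  classical
  ext p
  have hterm (z : (Word × Word) × (Word × Word)) :
      (if toPC z.1 * toPC z.2 = toPC p then (formalSum K S hS.finiteToFinite).coeff z.1 *
        (formalSum K T hT.finiteToFinite).coeff z.2 else 0) =
      if z.1 ∈ S ∧ z.2 ∈ T ∧ toPC z.1 * toPC z.2 = toPC p then 1 else 0 := by
    simp only [coeff_formalSum, ite_and, mul_ite, mul_one, mul_zero]
    split_ifs <;> rfl
  rw [coeff_mul, mulCoeff, finsum_congr hterm, coeff_formalSum]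
  split_ifs with hp
  · obtain ⟨q, hq, r, hr, hqr⟩ := hp
    rw [finsum_eq_single _ (q, r), if_pos ⟨hq, hr, hqr⟩]
    rintro z hz
    refine if_neg fun ⟨hq', hr', hqr'⟩ => hz ?_
    obtain ⟨h, h'⟩ := hS.factorization_unique hT hq' hr' hqr' hq hr hqr
    exact Prod.ext h h'
  · exact finsum_eq_zero_of_forall_eq_zero fun z =>
      if_neg fun ⟨hq, hr, hqr⟩ => hp ⟨z.1, hq, z.2, hr, hqr⟩

variable (K) in
/-- The inclusion of `PC(a, b)` into `ℬ_∞`. -/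
noncomputable def ofPC : PC →*₀ BInf K where
  toFun
    | PC.zero => 0
    | PC.pair y x => mono y x
  map_zero' := rfl
  map_one' := rfl
  map_mul' := by
    rintro (_ | ⟨v, u⟩) (_ | ⟨t, s⟩)
    · exact (mul_zero _).symm
    · exact (zero_mul _).symm
    · exact (mul_zero _).symm
    · change _ = mono (v, u).1 (v, u).2 * mono (t, s).1 (t, s).2
      rw [← formalSum_singleton, ← formalSum_singleton,
        formalSum_mul (isTable_singleton _) (isTable_singleton _)]
      change (match toPC (v, u) * toPC (t, s) with
        | PC.zero => (0 : BInf K)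
        | PC.pair y x => mono y x) = _
      rcases h : toPC (v, u) * toPC (t, s) with _ | ⟨y, x⟩
      · rw [formalSum_congr (mulRel_singleton_eq_empty h), formalSum_empty]
      · rw [formalSum_congr (mulRel_singleton (m := (y, x)) h), formalSum_singleton]

theorem mono_mul_mono (y x : Word) : (mono y [] * mono [] x : BInf K) = mono y x :=
  (map_mul (ofPC K) _ _).symm.trans (congrArg (ofPC K) (PC.word_mul_wordInv y x))

theorem mono_nil_append (w z : Word) : (mono [] (w ++ z) : BInf K) = mono [] z * mono [] w :=
  (congrArg (ofPC K) (PC.wordInv_append w z)).trans (map_mul ..)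

theorem mono_nil_injective : Function.Injective (mono [] : Word → BInf K) := fun w w' h => by
  have hcoeff := congrArg (fun s : BInf K => s.coeff ([], w)) h
  simpa [coeff_mono] using hcoeff

theorem mono_mul_formalSum_of_sends {S : Set (Word × Word)} (hS : IsTable S) {v w : Word}
    (h : Sends S v w) : mono [] w * formalSum K S hS.finiteToFinite = mono [] v := by
  rw [← formalSum_singleton ([], w), formalSum_mul (isTable_singleton _) hS,
    formalSum_congr (hS.mulRel_wordInv h), formalSum_singleton ([], v)]

theorem mono_mul_formalSum_eq_zero {S : Set (Word × Word)} (hS : IsTable S) {w : Word}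
    (h : ∀ p ∈ S, ¬∃ x z, w ++ x = p.1 ++ z) :
    mono [] w * formalSum K S hS.finiteToFinite = 0 := by
  rw [← formalSum_singleton ([], w), formalSum_mul (isTable_singleton _) hS,
    formalSum_congr (mulRel_wordInv_eq_empty h), formalSum_empty]

theorem mono_mul_diag_mul_mono (t : Word × Word) {Q : Set Word} (hQ : IsPrefixCode Q) :
    mono t.1 [] * diag Q * mono [] t.2 =
      formalSum K (extend t Q) (isTable_extend t hQ).finiteToFinite := by
  rw [← formalSum_extend_nil (isTable_extend _ hQ).finiteToFinite,
    ← formalSum_singleton (t.1, []), ← formalSum_singleton ([], t.2),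
    formalSum_mul (isTable_singleton _) (isTable_extend _ hQ),
    formalSum_mul ((isTable_singleton _).mulRel (isTable_extend _ hQ)) (isTable_singleton _),
    formalSum_congr (mulRel_mulRel_extend t Q)]

theorem isSum_formalSum {I : Type*} {S : I → Set (Word × Word)} (hS : ∀ i, FiniteToFinite (S i))
    (hdisjoint : Pairwise (Function.onFun Disjoint S)) (h : FiniteToFinite (⋃ i, S i)) :
    IsSum (fun i => formalSum K (S i) (hS i)) (formalSum K (⋃ i, S i) h) := by
  classical
  intro p
  have hunique {i j : I} (hi : p ∈ S i) (hj : p ∈ S j) : i = j :=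
    hdisjoint.eq fun hd => Set.disjoint_left.1 hd hi hj
  simp only [coeff_formalSum, ne_eq, ite_eq_right_iff, one_ne_zero, imp_false, not_not]
  refine ⟨Set.Subsingleton.finite fun _ hi _ hj => hunique hi hj, ?_⟩
  split_ifs with hp
  · obtain ⟨i, hi⟩ := Set.mem_iUnion.1 hp
    rw [finsum_eq_single _ i fun j hj => if_neg fun hj' => hj (hunique hj' hi), if_pos hi]
  · exact (finsum_eq_zero_of_forall_eq_zero fun i =>
      if_neg fun hi => hp (Set.mem_iUnion.2 ⟨i, hi⟩)).symm

theorem isSum_mono {I : Type*} {f : I → Word × Word} (hf : Function.Injective f)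
    (h : FiniteToFinite (Set.range f)) :
    IsSum (fun i => (mono (f i).1 (f i).2 : BInf K)) (formalSum K (Set.range f) h) := by
  have hsum := isSum_formalSum (K := K) (fun i => (isTable_singleton (f i)).finiteToFinite)
    (fun i j hij => Set.disjoint_singleton.2 (hf.ne hij))
    (by rwa [Set.iUnion_singleton_eq_range])
  simpa only [formalSum_singleton, Set.iUnion_singleton_eq_range] using hsum

theorem IsSum.unique {I : Type*} {f : I → BInf K} {s t : BInf K} (hs : IsSum f s)
    (ht : IsSum f t) : s = t :=
  BInf.ext fun p => (hs p).2.trans (ht p).2.symm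

theorem IsSum.sub {I : Type*} {f g : I → BInf K} {s t : BInf K} (hs : IsSum f s)
    (ht : IsSum g t) : IsSum (fun i => f i - g i) (s - t) := fun p => by
  refine ⟨((hs p).1.union (ht p).1).subset fun i hi => ?_, ?_⟩
  · by_contra! hfg
    simp only [Set.mem_union, Set.mem_ofPred_eq, not_or, not_not] at hfg
    exact hi (by rw [coeff_sub, hfg.1, hfg.2, sub_zero])
  · rw [coeff_sub, (hs p).2, (ht p).2, ← finsum_sub_distrib (hs p).1 (ht p).1]
    exact finsum_congr fun i => (coeff_sub ..).symm

theorem isSum_refinement {I : Type*} {f : I → Word × Word} {Q : I → Set Word}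
    (hf : Function.Injective f) (hT : IsTotalTable (Set.range f))
    (hQ : ∀ i, IsMaximalPrefixCode (Q i)) :
    IsSum (fun i => mono (f i).1 [] * (diag (Q i) - 1) * mono [] (f i).2)
      (formalSum K _ (isTotalTable_iUnion_extend hf hT hQ).finiteToFinite -
        formalSum K _ hT.finiteToFinite) := by
  have hterm (i : I) : (mono (f i).1 [] * (diag (Q i) - 1) * mono [] (f i).2 : BInf K) =
      formalSum K (extend (f i) (Q i)) (isTable_extend (f i) (hQ i).1).finiteToFinite -
        mono (f i).1 (f i).2 := by
    rw [mul_sub, sub_mul, mul_one, mono_mul_diag_mul_mono _ (hQ i).1, mono_mul_mono]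
  simp only [hterm]
  exact (isSum_formalSum _ (pairwise_disjoint_extend hf hT.toIsTable Q) _).sub (isSum_mono hf _)

end BInf

variable {K : Type*} [Field K]

/-! ### Unary sums and the ideal `I_∞` -/

theorem exists_enumeration {α : Type*} [Countable α] (S : Set α) :
    ∃ (I : Set ℕ) (f : I → α), Function.Injective f ∧ Set.range f = S := by
  obtain ⟨g, hg⟩ := exists_injective_nat S
  let e : S ≃ Set.range g := Equiv.ofInjective g hg
  refine ⟨_, Subtype.val ∘ e.symm, Subtype.val_injective.comp e.symm.injective, ?_⟩
  rw [EquivLike.range_comp, Subtype.range_coe]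

theorem IsTable.exists_enumeration {S : Set (Word × Word)} (hS : IsTable S) :
    ∃ (I : Set ℕ) (x y : I → Word), Function.Injective x ∧ Function.Injective y ∧
      Set.range x = Prod.snd '' S ∧ Set.range y = Prod.fst '' S ∧
      Set.range (fun i => (y i, x i)) = S := by
  have : Countable Letter := Finite.to_countable
  obtain ⟨I, f, hf, rfl⟩ := Thompson.exists_enumeration S
  exact ⟨I, Prod.snd ∘ f, Prod.fst ∘ f,
    fun i j h => hf (hS.injOn_snd ⟨i, rfl⟩ ⟨j, rfl⟩ h),
    fun i j h => hf (hS.injOn_fst ⟨i, rfl⟩ ⟨j, rfl⟩ h),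
    Set.range_comp .., Set.range_comp .., rfl⟩

theorem injective_prodMk {I α β : Type*} {x : I → α} (hx : Function.Injective x) (y : I → β) :
    Function.Injective fun i => (y i, x i) :=
  fun _ _ h => hx (congrArg Prod.snd h)

namespace BInf

theorem mem_UInfPart_iff {s : BInf K} : s ∈ UInfPart K ↔
    ∃ (S : Set (Word × Word)) (hS : IsTable S), formalSum K S hS.finiteToFinite = s := by
  constructor
  · rintro ⟨I, x, y, hx, hy, hX, hY, hs⟩
    have hS := isTable_range hx hy hX hY
    exact ⟨_, hS, (isSum_mono (injective_prodMk hx y) _).unique hs⟩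
  · rintro ⟨S, hS, rfl⟩
    obtain ⟨I, x, y, hx, hy, hX, hY, rfl⟩ := hS.exists_enumeration
    exact ⟨I, x, y, hx, hy, hX ▸ hS.isPrefixCode_snd, hY ▸ hS.isPrefixCode_fst,
      isSum_mono (injective_prodMk hx y) _⟩

theorem mem_UInf_iff {s : BInf K} : s ∈ UInf K ↔
    ∃ (S : Set (Word × Word)) (hS : IsTotalTable S), formalSum K S hS.finiteToFinite = s := by
  constructor
  · rintro ⟨I, x, y, hx, hy, hX, hY, hs⟩
    have hS := isTotalTable_range hx hy hX hY
    exact ⟨_, hS, (isSum_mono (injective_prodMk hx y) _).unique hs⟩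
  · rintro ⟨S, hS, rfl⟩
    obtain ⟨I, x, y, hx, hy, hX, hY, rfl⟩ := hS.exists_enumeration
    exact ⟨I, x, y, hx, hy, hX ▸ hS.isMaximalPrefixCode_snd, hY ▸ hS.isMaximalPrefixCode_fst,
      isSum_mono (injective_prodMk hx y) _⟩

theorem formalSum_mem_AInf {S : Set (Word × Word)} (hS : IsTable S) :
    formalSum K S hS.finiteToFinite ∈ AInf K :=
  Algebra.subset_adjoin (mem_UInfPart_iff.2 ⟨S, hS, rfl⟩)

end BInf

open BInf

variable (K) in
/-- The unary sum `∑ y x⁻¹` over the pairs `(y, x)` of a table, as an element of `𝒜_∞`. -/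
noncomputable def unarySum (S : Set (Word × Word)) (hS : IsTable S) : AInf K :=
  ⟨formalSum K S hS.finiteToFinite, formalSum_mem_AInf hS⟩

theorem IInf_eq_span : IInf K = TwoSidedIdeal.span {s | ∃ (S T : Set (Word × Word))
    (hS : IsTotalTable S) (hT : IsTotalTable T), Refines S T ∧
      unarySum K S hS.toIsTable - unarySum K T hT.toIsTable = s} := by
  refine congrArg TwoSidedIdeal.span (Set.ext fun s => ⟨?_, ?_⟩)
  · rintro ⟨I, x, y, Q, hx, hy, hX, hY, hQ, hs⟩
    have hf := injective_prodMk hx y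
    have hT := isTotalTable_range hx hy hX hY
    exact ⟨_, _, isTotalTable_iUnion_extend hf hT hQ, hT, refines_iUnion_extend _ Q,
      Subtype.ext ((isSum_refinement hf hT hQ).unique hs)⟩
  · rintro ⟨S, T, hS, hT, hST, rfl⟩
    obtain ⟨I, x, y, hx, hy, hX, hY, rfl⟩ := hT.exists_enumeration
    have hQ (i : I) : IsMaximalPrefixCode (extensions S (y i, x i)) :=
      hS.isMaximalPrefixCode_extensions hT.toIsTable hST ⟨i, rfl⟩
    refine ⟨I, x, y, _, hx, hy, hX ▸ hT.isMaximalPrefixCode_snd,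
      hY ▸ hT.isMaximalPrefixCode_fst, hQ, ?_⟩
    simpa only [unarySum, AddSubgroupClass.coe_sub, formalSum_congr hST.iUnion_extend]
      using isSum_refinement (K := K) (injective_prodMk hx y) hT hQ

/-! ### Local vanishing -/

/-- `s` vanishes locally: `w⁻¹ s = 0` for all words `w` of an essential right ideal. All elements
of `I_∞` have this property, which separates the elements of the group `𝒰_∞ / I_∞`. -/
def VanishesLocally (s : BInf K) : Prop :=
  ∀ u : Word, ∃ x : Word, mono [] (u ++ x) * s = 0

namespace VanishesLocally

theorem zero : VanishesLocally (0 : BInf K) := fun _ => ⟨[], mul_zero _⟩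

theorem add {s t : BInf K} (hs : VanishesLocally s) (ht : VanishesLocally t) :
    VanishesLocally (s + t) := fun u => by
  obtain ⟨x, hx⟩ := hs u
  obtain ⟨z, hz⟩ := ht (u ++ x)
  refine ⟨x ++ z, ?_⟩
  rw [← List.append_assoc, mul_add, hz, add_zero, mono_nil_append, mul_assoc, hx, mul_zero]

theorem neg {s : BInf K} (hs : VanishesLocally s) : VanishesLocally (-s) := fun u =>
  (hs u).imp fun x hx => by rw [mul_neg, hx, neg_zero]

theorem mul_right {s : BInf K} (hs : VanishesLocally s) (t : BInf K) : VanishesLocally (s * t) :=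
  fun u => (hs u).imp fun x hx => by rw [← mul_assoc, hx, zero_mul]

theorem formalSum_mul {s : BInf K} (hs : VanishesLocally s) {S : Set (Word × Word)}
    (hS : IsTable S) : VanishesLocally (formalSum K S hS.finiteToFinite * s) := fun u => by
  by_cases h : ∃ p ∈ S, ∃ x z, u ++ x = p.1 ++ z
  · obtain ⟨p, hp, x, z, hxz⟩ := h
    obtain ⟨c, hc⟩ := hs (p.2 ++ z)
    have hsends : Sends S (p.2 ++ z ++ c) (u ++ (x ++ c)) := by
      rw [← List.append_assoc, hxz]
      exact ((sends_of_mem hp).append z).append c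
    exact ⟨x ++ c, by rw [← mul_assoc, mono_mul_formalSum_of_sends hS hsends, hc]⟩
  · push Not at h
    refine ⟨[], ?_⟩
    rw [List.append_nil, ← mul_assoc, mono_mul_formalSum_eq_zero hS (by simpa using h), zero_mul]

theorem mul_left {s t : BInf K} (ht : t ∈ AInf K) (hs : VanishesLocally s) :
    VanishesLocally (t * s) := by
  induction ht using Algebra.adjoin_induction generalizing s with
  | mem t ht =>
    obtain ⟨S, hS, rfl⟩ := mem_UInfPart_iff.1 ht
    exact hs.formalSum_mul hS
  | algebraMap c =>
    rw [Algebra.commutes]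
    exact hs.mul_right _
  | add t t' _ _ h h' =>
    rw [add_mul]
    exact (h hs).add (h' hs)
  | mul t t' _ _ h h' =>
    rw [mul_assoc]
    exact h (h' hs)

end VanishesLocally

theorem vanishesLocally_sub {S T : Set (Word × Word)} (hS : IsTotalTable S) (hT : IsTable T)
    (hST : Refines S T) : VanishesLocally
      (formalSum K S hS.finiteToFinite - formalSum K T hT.finiteToFinite) := fun u => by
  obtain ⟨x, w, hw⟩ := hS.exists_sends_target u
  exact ⟨x, by rw [mul_sub, mono_mul_formalSum_of_sends hS.toIsTable hw,
    mono_mul_formalSum_of_sends hT (hST.sends hw), sub_self]⟩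

theorem vanishesLocally_of_mem_IInf {s : AInf K} (hs : s ∈ IInf K) :
    VanishesLocally (s : BInf K) := by
  let J : TwoSidedIdeal (AInf K) := TwoSidedIdeal.mk' {s | VanishesLocally (s : BInf K)}
    .zero .add .neg (fun {t _} => .mul_left t.2) fun {_ t} hs => hs.mul_right (t : BInf K)
  have hle : IInf K ≤ J := by
    rw [IInf_eq_span, TwoSidedIdeal.span_le]
    rintro _ ⟨S, T, hS, hT, hST, rfl⟩
    exact (TwoSidedIdeal.mem_mk' ..).2 (vanishesLocally_sub hS hT.toIsTable hST)
  exact (TwoSidedIdeal.mem_mk' ..).1 (hle hs)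

/-! ### The group `𝒰_∞ / I_∞` -/

variable (K) in
/-- The class in `𝒞_∞` of the unary sum of a table. -/
noncomputable def unaryClass (S : Set (Word × Word)) (hS : IsTable S) : CInf K :=
  (IInf K).ringCon.mk' (unarySum K S hS)

theorem unaryClass_congr {S T : Set (Word × Word)} {hS : IsTable S} (h : S = T) :
    unaryClass K S hS = unaryClass K T (h ▸ hS) := by
  subst h
  rfl

theorem unaryClass_one : unaryClass K {([], [])} (isTable_singleton _) = 1 :=
  (congrArg (IInf K).ringCon.mk' (Subtype.ext (formalSum_singleton _))).trans (map_one _)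

theorem unaryClass_mul {S T : Set (Word × Word)} (hS : IsTable S) (hT : IsTable T) :
    unaryClass K S hS * unaryClass K T hT = unaryClass K (mulRel S T) (hS.mulRel hT) :=
  (map_mul (IInf K).ringCon.mk' _ _).symm.trans
    (congrArg (IInf K).ringCon.mk' (Subtype.ext (formalSum_mul hS hT)))

theorem unaryClass_eq_iff {S T : Set (Word × Word)} {hS : IsTable S} {hT : IsTable T} :
    unaryClass K S hS = unaryClass K T hT ↔ unarySum K S hS - unarySum K T hT ∈ IInf K := by
  rw [← TwoSidedIdeal.rel_iff]
  exact RingCon.eq _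

theorem unaryClass_eq_of_refines {S T : Set (Word × Word)} (hS : IsTotalTable S)
    (hT : IsTotalTable T) (h : Refines S T) :
    unaryClass K S hS.toIsTable = unaryClass K T hT.toIsTable := by
  rw [unaryClass_eq_iff, IInf_eq_span]
  exact TwoSidedIdeal.subset_span ⟨S, T, hS, hT, h, rfl⟩

variable (K) in
/-- The homomorphism from `𝒢_{2,1}` to `𝒞_∞` that sends `φ` to the class of its table. -/
noncomputable def toCInf : G21 →* CInf K where
  toFun φ := unaryClass K (table φ.1) φ.isTotalTable_table.toIsTable
  map_one' := (unaryClass_congr G21.table_one).trans unaryClass_one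
  map_mul' φ ψ := by
    rw [unaryClass_mul]
    exact (unaryClass_eq_of_refines (φ.isTotalTable_table.mulRel ψ.isTotalTable_table)
      (φ * ψ).isTotalTable_table (G21.refines_mulRel_table φ ψ)).symm

theorem eq_of_vanishesLocally_sub {φ ψ : G21} (h : VanishesLocally
    (formalSum K _ φ.isTotalTable_table.finiteToFinite -
      formalSum K _ ψ.isTotalTable_table.finiteToFinite)) : φ = ψ := by
  refine G21.eq_of_dense fun u => ?_
  obtain ⟨x, v, hv⟩ := φ.isTotalTable_table.exists_sends_target u
  obtain ⟨x', v', hv'⟩ := ψ.isTotalTable_table.exists_sends_target (u ++ x)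
  obtain ⟨x'', hx''⟩ := h (u ++ x ++ x')
  have hφ := (hv.append x').append x''
  have hψ := hv'.append x''
  rw [mul_sub, mono_mul_formalSum_of_sends φ.isTotalTable_table.toIsTable hφ,
    mono_mul_formalSum_of_sends ψ.isTotalTable_table.toIsTable hψ, sub_eq_zero] at hx''
  have hvv' : v ++ x' ++ x'' = v' ++ x'' := mono_nil_injective hx''
  refine ⟨x ++ x' ++ x'', v' ++ x'', ?_, ?_⟩
  · simpa [← hvv'] using φ.sends_table_iff.1 hφ
  · simpa using ψ.sends_table_iff.1 hψ

theorem toCInf_injective : Function.Injective (toCInf K) := fun _ _ h =>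
  eq_of_vanishesLocally_sub (K := K) (vanishesLocally_of_mem_IInf (unaryClass_eq_iff.1 h))

theorem range_toCInf : Set.range (toCInf K) = UInfmodIInf K := by
  ext c
  constructor
  · rintro ⟨φ, rfl⟩
    exact ⟨_, mem_UInf_iff.2 ⟨_, φ.isTotalTable_table, rfl⟩, rfl⟩
  · rintro ⟨s, hs, rfl⟩
    obtain ⟨S, hS, h⟩ := mem_UInf_iff.1 hs
    obtain ⟨φ, hφ⟩ := G21.exists_refines_table hS
    exact ⟨φ, (unaryClass_eq_of_refines hS φ.isTotalTable_table hφ).symm.trans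
      (congrArg (IInf K).ringCon.mk' (Subtype.ext h))⟩

/-! ### The Cuntz relation -/

section

variable {A : Type*} [Semiring A]

/-- The relation `a a⁻¹ + b b⁻¹ = 1` for the image of `PC(a, b)` in a semiring; it is the relation
that defines `𝒞_V` as a quotient of `K[PC(a, b)]`. -/
def CuntzRelation (f : PC →*₀ A) : Prop :=
  f (PC.pair [Letter.a] [Letter.a]) + f (PC.pair [Letter.b] [Letter.b]) = 1

variable {f : PC →*₀ A} {S T : Set (Word × Word)}

theorem CuntzRelation.eq_of_letters (hf : CuntzRelation f) {c d : A}
    (h : ∀ l, f (PC.wordInv [l]) * c = f (PC.wordInv [l]) * d) : c = d := by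
  rw [← one_mul c, ← one_mul d, ← hf, ← PC.word_mul_wordInv, ← PC.word_mul_wordInv,
    map_mul, map_mul, add_mul, add_mul, mul_assoc, mul_assoc, mul_assoc, mul_assoc, h, h]

theorem CuntzRelation.eq_of_length (hf : CuntzRelation f) {c d : A} (n : ℕ)
    (h : ∀ w : Word, n ≤ w.length → f (PC.wordInv w) * c = f (PC.wordInv w) * d) : c = d := by
  induction n with
  | zero =>
    have hone : f (PC.wordInv []) = 1 := map_one f
    simpa only [hone, one_mul] using h [] le_rfl
  | succ n ih =>
    refine ih fun w hw => hf.eq_of_letters fun l => ?_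
    rw [← mul_assoc, ← mul_assoc, ← map_mul, ← PC.wordInv_append]
    exact h (w ++ [l]) (by simpa using hw)

theorem IsTotalTable.exists_sends_of_length (hS : IsTotalTable S) (hfin : S.Finite) :
    ∃ n, ∀ w : Word, n ≤ w.length → ∃ v, Sends S v w := by
  obtain ⟨n, hn⟩ := (hfin.image fun p => p.1.length).bddAbove
  refine ⟨n, fun w hw => ?_⟩
  obtain ⟨p, hp, x, z, h⟩ := hS.fst_total w
  obtain ⟨z', rfl⟩ : p.1 <+: w :=
    List.prefix_of_prefix_length_le ⟨z, h.symm⟩ ⟨x, rfl⟩ ((hn ⟨p, hp, rfl⟩).trans hw)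
  exact ⟨_, (sends_of_mem hp).append z'⟩

theorem CuntzRelation.eq_of_sends (hf : CuntzRelation f) (hS : IsTotalTable S) (hfin : S.Finite)
    {c d : A} (h : ∀ v w, Sends S v w → f (PC.wordInv w) * c = f (PC.wordInv w) * d) : c = d := by
  obtain ⟨n, hn⟩ := hS.exists_sends_of_length hfin
  exact hf.eq_of_length n fun w hw => (hn w hw).elim fun v => h v w

theorem finite_mulRel (hS : S.Finite) (hT : T.Finite) : (mulRel S T).Finite := by
  refine Set.Finite.subset (((hS.image toPC).mul (hT.image toPC)).preimage
    toPC_injective.injOn) ?_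
  rintro p ⟨q, hq, r, hr, h⟩
  exact Set.mem_mul.2 ⟨_, ⟨q, hq, rfl⟩, _, ⟨r, hr, rfl⟩, h⟩

/-! ### Finite sums -/

variable (f) in
/-- The image under `f` of the sum `∑ y x⁻¹` over the pairs `(y, x)` of a finite table. -/
noncomputable def tableSum (S : Set (Word × Word)) : A := ∑ᶠ p ∈ S, f (toPC p)

theorem wordInv_mul_tableSum (hS : IsTable S) (hfin : S.Finite) {v w : Word} (h : Sends S v w) :
    f (PC.wordInv w) * tableSum f S = f (PC.wordInv v) := by
  obtain ⟨p, hp, hgraph⟩ := h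
  lift S to Finset (Word × Word) using hfin
  rw [tableSum, finsum_mem_coe_finset, Finset.mul_sum, Finset.sum_eq_single_of_mem p hp,
    ← map_mul, wordInv_mul_toPC hgraph]
  intro q hq hne
  rw [← map_mul, hS.wordInv_mul_toPC_eq_zero hp hgraph hq hne, map_zero]

theorem CuntzRelation.tableSum_eq_of_refines (hf : CuntzRelation f) (hS : IsTotalTable S)
    (hT : IsTable T) (hSfin : S.Finite) (hTfin : T.Finite) (h : Refines S T) :
    tableSum f S = tableSum f T :=
  hf.eq_of_sends hS hSfin fun v w hvw => by
    rw [wordInv_mul_tableSum hS.toIsTable hSfin hvw, wordInv_mul_tableSum hT hTfin (h.sends hvw)]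

theorem CuntzRelation.tableSum_mulRel (hf : CuntzRelation f) (hS : IsTotalTable S)
    (hT : IsTotalTable T) (hSfin : S.Finite) (hTfin : T.Finite) :
    tableSum f (mulRel S T) = tableSum f S * tableSum f T := by
  have hST := hS.mulRel hT
  have hfin := finite_mulRel hSfin hTfin
  refine hf.eq_of_sends hST hfin fun v w hvw => ?_
  obtain ⟨m, hm, hm'⟩ := sends_mulRel.1 hvw
  rw [wordInv_mul_tableSum hST.toIsTable hfin hvw, ← mul_assoc,
    wordInv_mul_tableSum hS.toIsTable hSfin hm', wordInv_mul_tableSum hT.toIsTable hTfin hm]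

theorem V.isTotalTable_table (φ : V) : IsTotalTable (table φ.1.1) := G21.isTotalTable_table φ.1

/-- The homomorphism from `V` to a semiring with the Cuntz relation that sends `φ` to the sum of its
table. -/
noncomputable def CuntzRelation.toHom (hf : CuntzRelation f) : V →* A where
  toFun φ := tableSum f (table φ.1.1)
  map_one' := by
    have htable : table (1 : V).1.1 = {([], [])} := G21.table_one
    rw [htable, tableSum, finsum_mem_singleton]
    exact map_one f
  map_mul' φ ψ := by
    have hφ := V.isTotalTable_table φ
    have hψ := V.isTotalTable_table ψ
    rw [← hf.tableSum_mulRel hφ hψ (V.finite_table φ) (V.finite_table ψ)]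
    exact (hf.tableSum_eq_of_refines (hφ.mulRel hψ) (V.isTotalTable_table (φ * ψ)).toIsTable
      (finite_mulRel (V.finite_table φ) (V.finite_table ψ)) (V.finite_table (φ * ψ))
      (G21.refines_mulRel_table φ.1 ψ.1)).symm

theorem CuntzRelation.range_toHom (hf : CuntzRelation f) :
    Set.range hf.toHom = {c | ∃ S, IsTotalTable S ∧ S.Finite ∧ tableSum f S = c} := by
  ext c
  constructor
  · rintro ⟨φ, rfl⟩
    exact ⟨_, V.isTotalTable_table φ, V.finite_table φ, rfl⟩
  · rintro ⟨S, hS, hfin, rfl⟩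
    obtain ⟨φ, hφ⟩ := G21.exists_refines_table hS
    let φ' : V := ⟨φ, mem_V_of_finite_refines hS hfin hφ⟩
    exact ⟨φ', (hf.tableSum_eq_of_refines hS (V.isTotalTable_table φ').toIsTable hfin
      (V.finite_table φ') hφ).symm⟩

end

/-! ### The algebra `𝒞_V` -/

theorem ringCon_span_le_ker {R S : Type*} [Ring R] [Ring S] (f : R →+* S) {r : R} (h : f r = 0) :
    (TwoSidedIdeal.span {r}).ringCon ≤ RingCon.ker f := by
  have hle : TwoSidedIdeal.span {r} ≤ TwoSidedIdeal.ker f :=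
    TwoSidedIdeal.span_le.2 (by rintro _ rfl; exact (TwoSidedIdeal.mem_ker f).2 h)
  intro x y hxy
  have hsub := (TwoSidedIdeal.mem_ker f).1 (hle ((TwoSidedIdeal.rel_iff _ x y).1 hxy))
  rwa [map_sub, sub_eq_zero] at hsub

variable (K) in
/-- The canonical homomorphism from `PC(a, b)` to `𝒞_V`. -/
noncomputable def pcToCV : PC →*₀ CV K where
  toFun c := (IV K).ringCon.mk' (RingCon.mk' _ (MonoidAlgebra.single c (1 : K)))
  map_zero' := by
    have hzero : (RingCon.mk' _ (MonoidAlgebra.single (0 : PC) (1 : K)) : KPC K) = 0 :=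
      (RingCon.eq _).2 (TwoSidedIdeal.subset_span rfl)
    exact (congrArg (IV K).ringCon.mk' hzero).trans (map_zero _)
  map_one' := rfl
  map_mul' c d := by
    rw [← map_mul, ← map_mul, MonoidAlgebra.single_mul_single, mul_one]

theorem cuntzRelation_pcToCV : CuntzRelation (pcToCV K) := by
  have h : (IV K).ringCon.mk'
      (kpair K [Letter.a] [Letter.a] + kpair K [Letter.b] [Letter.b] - 1) = 0 :=
    (RingCon.eq _).2 (TwoSidedIdeal.subset_span rfl)
  rwa [map_sub, map_add, map_one, sub_eq_zero] at h

section

variable {B : Type*} [Ring B] [Algebra K B] {g : PC →*₀ B}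

variable (K g) in
/-- The extension of a homomorphism on `PC(a, b)` to `K[PC(a, b)]`. -/
noncomputable def liftKPC : KPC K →+* B :=
  RingCon.lift _ (MonoidAlgebra.lift K B PC g).toRingHom <| ringCon_span_le_ker _ <|
    (MonoidAlgebra.lift_single _ _ _).trans (by simp)

theorem liftKPC_kpair (y x : Word) : liftKPC K g (kpair K y x) = g (PC.pair y x) :=
  (MonoidAlgebra.lift_single _ _ _).trans (one_smul _ _)

theorem CuntzRelation.exists_lift (hg : CuntzRelation g) :
    ∃ F : CV K →+* B, ∀ c, F (pcToCV K c) = g c := by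
  have hletters : liftKPC K g (kpair K [Letter.a] [Letter.a] + kpair K [Letter.b] [Letter.b] - 1)
      = 0 := by
    rw [map_sub, map_add, map_one, liftKPC_kpair, liftKPC_kpair, hg, sub_self]
  exact ⟨RingCon.lift _ (liftKPC K g) (ringCon_span_le_ker _ hletters), fun c =>
    (MonoidAlgebra.lift_single _ _ _).trans (one_smul _ _)⟩

end

variable (K) in
/-- The homomorphism from `V` to `𝒞_V` that sends `φ` to the sum of its table. -/
noncomputable def toCV : V →* CV K := cuntzRelation_pcToCV.toHom

theorem range_toCV : Set.range (toCV K) = UVmodIV K := by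
  rw [toCV, CuntzRelation.range_toHom]
  ext c
  constructor
  · rintro ⟨S, hS, hfin, rfl⟩
    obtain ⟨I, x, y, hx, hy, hX, hY, rfl⟩ := hS.exists_enumeration
    have hI : I.Finite := Set.finite_coe_iff.1 <|
      (Set.finite_range_iff (injective_prodMk hx y)).1 hfin
    lift I to Finset ℕ using hI
    refine ⟨_, ⟨I, x, y, hx, hy, hX ▸ hS.isMaximalPrefixCode_snd,
      hY ▸ hS.isMaximalPrefixCode_fst, rfl⟩, ?_⟩
    rw [tableSum, finsum_mem_range (injective_prodMk hx y), finsum_eq_sum_of_fintype, map_sum]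
    rfl
  · rintro ⟨_, ⟨I, x, y, hx, hy, hX, hY, rfl⟩, rfl⟩
    refine ⟨_, isTotalTable_range hx hy hX hY, Set.finite_range _, ?_⟩
    rw [tableSum, finsum_mem_range (injective_prodMk hx y), finsum_eq_sum_of_fintype, map_sum]
    rfl

/-! ### The homomorphism from `𝒞_V` to `𝒞_∞` -/

theorem BInf.sum_mono (S : Finset (Word × Word)) (h : FiniteToFinite (S : Set (Word × Word))) :
    ∑ p ∈ S, (mono p.1 p.2 : BInf K) = formalSum K S h := by
  classical
  ext q
  let coeffHom : BInf K →+ K := ⟨⟨(BInf.coeff · q), rfl⟩, fun _ _ => rfl⟩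
  calc coeffHom (∑ p ∈ S, mono p.1 p.2) = ∑ p ∈ S, if q = p then 1 else 0 := map_sum ..
    _ = if q ∈ S then 1 else 0 := Finset.sum_ite_eq ..
    _ = (formalSum K S h).coeff q := by simp only [coeff_formalSum, Finset.mem_coe]

theorem BInf.ofPC_mem_AInf (c : PC) : ofPC K c ∈ AInf K := by
  rcases c with _ | ⟨y, x⟩
  · exact zero_mem _
  · have hmem := formalSum_mem_AInf (K := K) (isTable_singleton (y, x))
    rwa [formalSum_singleton] at hmem

variable (K) in
/-- The canonical homomorphism from `PC(a, b)` to `𝒞_∞`. -/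
noncomputable def pcToCInf : PC →*₀ CInf K where
  toFun c := (IInf K).ringCon.mk' ⟨BInf.ofPC K c, BInf.ofPC_mem_AInf c⟩
  map_zero' := map_zero (IInf K).ringCon.mk'
  map_one' := map_one (IInf K).ringCon.mk'
  map_mul' c d := by
    rw [← map_mul]
    exact congrArg (IInf K).ringCon.mk' (Subtype.ext (map_mul (BInf.ofPC K) c d))

theorem tableSum_pcToCInf {S : Set (Word × Word)} (hS : IsTable S) (hfin : S.Finite) :
    tableSum (pcToCInf K) S = unaryClass K S hS := by
  lift S to Finset (Word × Word) using hfin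
  rw [tableSum, finsum_mem_coe_finset, unaryClass]
  change ∑ p ∈ S, (IInf K).ringCon.mk' ⟨BInf.ofPC K (toPC p), BInf.ofPC_mem_AInf _⟩ = _
  rw [← map_sum]
  refine congrArg (IInf K).ringCon.mk' (Subtype.ext ?_)
  rw [AddSubmonoidClass.coe_finsetSum]
  exact BInf.sum_mono S hS.finiteToFinite

theorem isMaximalPrefixCode_letters : IsMaximalPrefixCode (Set.range fun l : Letter => [l]) := by
  rw [isMaximalPrefixCode_iff]
  refine ⟨?_, ?_⟩
  · rintro _ ⟨l, rfl⟩ _ ⟨l', rfl⟩ h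
    exact h.eq_of_length rfl
  · rintro (_ | ⟨l, u⟩)
    · exact ⟨_, ⟨Letter.a, rfl⟩, [Letter.a], [], rfl⟩
    · exact ⟨_, ⟨l, rfl⟩, [], u, by simp⟩

theorem cuntzRelation_pcToCInf : CuntzRelation (pcToCInf K) := by
  have hinj : Function.Injective fun l : Letter => [l] := List.singleton_injective
  have hS := isTotalTable_range hinj hinj isMaximalPrefixCode_letters isMaximalPrefixCode_letters
  have hrefines : Refines (Set.range fun l : Letter => ([l], [l])) {([], [])} := by
    rintro _ ⟨l, rfl⟩
    exact ⟨_, rfl, [l], rfl, rfl⟩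
  calc pcToCInf K (PC.pair [Letter.a] [Letter.a]) + pcToCInf K (PC.pair [Letter.b] [Letter.b])
      = ∑ l : Letter, pcToCInf K (PC.pair [l] [l]) :=
        (Finset.sum_pair (f := fun l => pcToCInf K (PC.pair [l] [l])) Letter.noConfusion).symm
    _ = tableSum (pcToCInf K) (Set.range fun l : Letter => ([l], [l])) := by
      rw [tableSum, finsum_mem_range (injective_prodMk hinj _), finsum_eq_sum_of_fintype]
      rfl
    _ = unaryClass K _ hS.toIsTable := tableSum_pcToCInf hS.toIsTable (Set.finite_range _)
    _ = 1 := (unaryClass_eq_of_refines hS isTotalTable_one hrefines).trans unaryClass_one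

theorem exists_map_toCV : ∃ F : CV K →+* CInf K, ∀ φ : V, F (toCV K φ) = toCInf K φ.1 := by
  obtain ⟨F, hF⟩ := (cuntzRelation_pcToCInf (K := K)).exists_lift (K := K)
  refine ⟨F, fun φ => ?_⟩
  calc F (toCV K φ) = tableSum (pcToCInf K) (table φ.1.1) :=
        (F.toAddMonoidHom.map_finsum_mem _ (V.finite_table φ)).trans
          (finsum_mem_congr rfl fun p _ => hF (toPC p))
    _ = toCInf K φ.1 := tableSum_pcToCInf _ (V.finite_table φ)

theorem toCV_injective : Function.Injective (toCV K) := fun φ ψ h => by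
  obtain ⟨F, hF⟩ := exists_map_toCV (K := K)
  exact Subtype.ext (toCInf_injective (K := K) (by rw [← hF, h, hF]))

theorem exists_subgroup_units {G M : Type*} [Group G] [Monoid M] {U : Set M} (f : G →* M)
    (hf : Function.Injective f) (hU : Set.range f = U) :
    ∃ H : Subgroup Mˣ, Units.val '' (H : Set Mˣ) = U ∧ Nonempty (G ≃* H) := by
  have hinj : Function.Injective f.toHomUnits := fun g g' h => hf (congrArg Units.val h)
  refine ⟨f.toHomUnits.range, ?_, ⟨MonoidHom.ofInjective hinj⟩⟩
  rw [← hU, MonoidHom.coe_range, ← Set.range_comp]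
  rfl

end Thompson

theorem mainTheorem3 (K : Type*) [Field K] :
    (∃ H : Subgroup (Thompson.CV K)ˣ,
      Units.val '' (H : Set (Thompson.CV K)ˣ) = Thompson.UVmodIV K ∧
        Nonempty (Thompson.V ≃* H)) ∧
    (∃ H : Subgroup (Thompson.CInf K)ˣ,
      Units.val '' (H : Set (Thompson.CInf K)ˣ) = Thompson.UInfmodIInf K ∧
        Nonempty (Thompson.G21 ≃* H)) :=
  ⟨Thompson.exists_subgroup_units (Thompson.toCV K) Thompson.toCV_injective Thompson.range_toCV,
    Thompson.exists_subgroup_units (Thompson.toCInf K) Thompson.toCInf_injective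
      Thompson.range_toCInf⟩
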